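/- **Setting.** There are $M$ subsystems with states $x_i\in\mathbb R^{n_i}$, inputs $u_i\in\mathbb R^{m_i}$ and neighborhoods $\mathcal N_i\subseteq\{1,\dots,M\}\setminus\{i\}$; the horizon is $N\ge1$. For each $i$ let $\mathcal X_i$ be convex and $\mathcal U_i$ closed and convex, and let $\mathcal X_i=\bigcup_{l=1}^{L_i}P_i^{(l)}$, where the regions $P_i^{(l)}$ are closed convex polyhedra with pairwise disjoint interiors. On region $l$ the update is $$g_i^{(l)}(x_i,u_i,\{x_j\}_{j\in\mathcal N_i})=A_i^{(l)}x_i+B_i^{(l)}u_i+c_i^{(l)}+\sum_{j\in\mathcal N_i}A_{ij}^{(l)}x_j .$$ The dynamics $x_i^+=f_i(x_i,u_i,\{x_j\}_{j\in\mathcal N_i})$ mean that $x_i^+=g_i^{(l)}(x_i,u_i,\{x_j\})$ for some $l$ with $x_i\in P_i^{(l)}$ (several values are possible only on a common boundary of regions). Coupled constraints are $h_i(x_i,\{x_j\}_{j\in\mathcal N_i})\le0$ with $h_i$ affine. Costs are $\ell_i=x_i^\top Q_ix_i+u_i^\top R_iu_i+\sum_{j\in\mathcal N_i}x_j^\top Q_{ij}x_j$,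 $V_{\mathrm f,i}=x_i^\top\Phi_ix_i$ and $F_i=\sum_{k<N}\ell_i(x_i(k),u_i(k),\{x_j^{(i)}(k)\})+V_{\mathrm f,i}(x_i(N))$. Given are gains $K_i^{(l)}$, terminal sets $\mathcal X_{\mathrm T,i}$, $\rho>0$ and $T_{\rm cut}\in\mathbb N$; let $\mathcal X_{\mathrm T}=\prod_i\mathcal X_{\mathrm T,i}$. **Problems.** A local variable $\mathbf y_i=(\tilde{\mathbf x}_i,\mathbf u_i)$ consists of $\tilde{\mathbf x}_i=(\mathbf x_i,(\mathbf x_j^{(i)})_{j\in\mathcal N_i})$, i.e. a trajectory $\mathbf x_i=(x_i(0),\dots,x_i(N))$ and copies $\mathbf x_j^{(i)}$ of the neighbors' trajectories, and of inputs $\mathbf u_i=(u_i(0),\dots,u_i(N-1))$. Let $\mathcal Y_i(x_i)$ be the set of $\mathbf y_i$ with $h_i(x_i(k),\{x_j^{(i)}(k)\})\le0$ and $x_i(k)\in\mathcal X_i$ for $0\le k\le N$, $u_i(k)\in\mathcal U_i$ for $0\le k<N$, $x_i(0)=x_i$ and $x_i(N)\in\mathcal X_{\mathrm T,i}$. For a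 switching sequence $s_i\in\{1,\dots,L_i\}^{N+1}$ let $\mathcal Y_i^{(s_i)}$ be the set of $\mathbf y_i$ with $x_i(k)\in P_i^{(s_i(k))}$ for $0\le k\le N$ and $x_i(k+1)=g_i^{(s_i(k))}(x_i(k),u_i(k),\{x_j^{(i)}(k)\})$ for $0\le k<N$. A family $\mathbf y=(\mathbf y_i)$ is consistent if $\mathbf x_j^{(i)}=\mathbf x_j$ for all $i$ and $j\in\mathcal N_i$. Let $\mathcal Y_s(x)$ be the set of consistent $\mathbf y$ with $\mathbf y_i\in\mathcal Y_i(x_i)\cap\mathcal Y_i^{(s_i)}$ for all $i$, and let $\mathcal Y(x)$, the feasible set of $\mathcal P_{\mathrm d}(x)$, be the set of consistent $\mathbf y$ with $\mathbf y_i\in\mathcal Y_i(x_i)$ and $x_i(k+1)=f_i(x_i(k),u_i(k),\{x_j^{(i)}(k)\})$ for all $i$ and $k<N$. Put $\mathcal X_0=\{x:\mathcal Y(x)\ne\emptyset\}$. **Switching sequences.** $\mathrm{Eval}_i(x_i,\mathbf u_i,\{\mathbf x_j^{(i)}\})$ is the set of all $s_i$ for which some $\xi(0)=x_i,\xi(1),\dots,\xi(N)$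 satisfies $\xi(k)\in\overline{P_i^{(s_i(k))}}$ for all $k$ and $\xi(k+1)=g_i^{(s_i(k))}(\xi(k),u_i(k),\{x_j^{(i)}(k)\})$ for $k<N$. A rollout of $\hat{\mathbf u}$ from $x$ is a consistent $\mathbf y$ with inputs $\hat{\mathbf u}$ and $x_i(0)=x_i$ that obeys the dynamics $f_i$. The guess $\hat{\mathbf u}$ is *weakly feasible* for $x$ if some rollout of it has, with $s_i\in\mathrm{Eval}_i(x_i,\hat{\mathbf u}_i,\{\mathbf x_j^{(i)}\})$ for all $i$, a switching sequence $s$ with $\mathcal Y_s(x)\ne\emptyset$. **Sw-ADMM** at $x$ with guess $\hat{\mathbf u}$ and a rollout of it: start with $\mathbf z^0=0$, $\boldsymbol\lambda^0=0$ and any $s_i\in\mathrm{Eval}_i(x_i,\hat{\mathbf u}_i,\cdot)$ (copies from the rollout). For $\tau=0,1,\dots$: $\mathbf y_i^{\tau+1}$ minimizes $F_i+(\boldsymbol\lambda_i^\tau)^\top\tilde{\mathbf x}_i+\frac\rho2\|\tilde{\mathbf x}_i-\tilde{\mathbf z}_i^\tau\|_2^2$ over $\mathcal Y_i(x_i)\cap\mathcal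 Y_i^{(s_i)}$, where $\tilde{\mathbf z}_i=(\mathbf z_i,(\mathbf z_j)_{j\in\mathcal N_i})$; $\mathbf z_i^{\tau+1}$ is the average of $\mathbf x_i^{\tau+1}$ and of all its copies $\mathbf x_i^{(j),\tau+1}$, $i\in\mathcal N_j$; $\boldsymbol\lambda_i^{\tau+1}=\boldsymbol\lambda_i^\tau+\rho(\tilde{\mathbf x}_i^{\tau+1}-\tilde{\mathbf z}_i^{\tau+1})$; and if $\tau<T_{\rm cut}$ and $\mathrm{Eval}_i(x_i,\mathbf u_i^{\tau+1},\{\mathbf x_j^{(i),\tau+1}\})\setminus\{s_i\}\neq\emptyset$, then $s_i$ is replaced by an element of this set; otherwise $s_i$ is kept. The number of iterations tends to infinity: an output is an accumulation point of $(\mathbf y^\tau)_\tau$ (the limit, if it exists). **Controller** (at each time $t$, with state $x$). If $x\in\mathcal X_{\mathrm T}$, apply $u_i=K_i^{(l)}x_i$ for some $l$ with $x_i\in P_i^{(l)}$. Otherwise take a guess $\hat{\mathbf u}$: at $t=0$ a given one, at $t>0$ the sequences $\hat{\mathbf u}_i=(\bar u_i(1),\dots,\bar u_i(N-1),K_i^{(l)}\bar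 x_i(N))$ with $\bar x_i(N)\in P_i^{(l)}$, where $(\bar{\mathbf x},\bar{\mathbf u})$ is the last stored solution. Compute a rollout $\mathbf y_{\rm dr}$ of $\hat{\mathbf u}$ and an output $\mathbf y$ of Sw-ADMM; let $F_{i,\rm dr}=F_i(\mathbf y_{i,\rm dr})$ if $\mathbf y_{\rm dr}\in\mathcal Y(x)$, and $F_{i,\rm dr}=\infty$ for all $i$ otherwise. If $F_i(\mathbf y_i)\le F_{i,\rm dr}$ fails for some $i$, replace $\mathbf y$ by $\mathbf y_{\rm dr}$. Store $\mathbf y$ and apply $u_i(0)$. The next state satisfies $x_i^+=f_i(x_i,u_i,\{x_j\}_{j\in\mathcal N_i})$. **Assumptions.** Write $\hat{\mathcal L}_i=\{l:0\in\overline{P_i^{(l)}}\}$. 1. For every $x\in\mathcal X_0$ there is no $s$ with $\mathcal Y_s(x)=\emptyset$ and $\mathcal Y_i(x_i)\cap\mathcal Y_i^{(s_i)}\ne\emptyset$ for all $i$. 2. The number of ADMM iterations tends to infinity, as described above. 3. All pairs $(A_i^{(l)},B_i^{(l)})$ are controllable, all $A_i^{(l)}+B_i^{(l)}K_i^{(l)}$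 are Schur, and $c_i^{(l)}=0$ for $l\in\hat{\mathcal L}_i$. 4. Each $\mathcal X_{\mathrm T,i}\subseteq\bigcup_{l\in\hat{\mathcal L}_i}P_i^{(l)}$ is closed and convex and contains $0$; for $x_i\in\mathcal X_{\mathrm T,i}\cap P_i^{(l)}$ and $x_j\in\mathcal X_{\mathrm T,j}$ ($j\in\mathcal N_i$) one has $K_i^{(l)}x_i\in\mathcal U_i$ and $g_i^{(l)}(x_i,K_i^{(l)}x_i,\{x_j\})\in\mathcal X_{\mathrm T,i}$; and $h_i(x_i,\{x_j\})\le0$ for all $x\in\mathcal X_{\mathrm T}$ and all $i$. 5. $Q_i,R_i,\Phi_i$ are positive definite and $Q_{ij}$ positive semidefinite, and $\sum_i\big(V_{\mathrm f,i}(x_i^+)-V_{\mathrm f,i}(x_i)+\ell_i(x_i,u_i,\{x_j\})\big)\le0$ for all $x\in\mathcal X_{\mathrm T}$ and all $l_i$ with $x_i\in P_i^{(l_i)}$, where $u_i=K_i^{(l_i)}x_i$ and $x_i^+=g_i^{(l_i)}(x_i,u_i,\{x_j\})$. 6. The guess at $t=0$ is weakly feasible for the initial state. **Theorem.** Let Assumptions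 1–6 hold, let $x(0)\in\mathcal X_0\setminus\mathcal X_{\mathrm T}$, and let $x(0),x(1),\dots,x(T)$, $T\ge 0$ arbitrary, be states of the closed loop under the controller above, such that the state update is unambiguous along it (if $x_i(t)$, $t<T$, lies in several regions, their updates agree at $x(t)$ and the applied input). Then for every $t\le T$ with $x(t)\notin\mathcal X_{\mathrm T}$ the problem $\mathcal P_{\mathrm d}(x(t))$ is feasible, i.e. $\mathcal Y(x(t))\neq\emptyset$. Moreover, at each such $t$ every infinite sequence of Sw-ADMM iterates at $x(t)$ has an accumulation point. -/

import Mathlib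

open Matrix Filter Topology

/-- A closed convex polyhedron: a finite intersection of closed half-spaces. -/
def IsPolyhedron {d : ℕ} (P : Set (Fin d → ℝ)) : Prop :=
  ∃ (r : ℕ) (a : Fin r → Fin d → ℝ) (b : Fin r → ℝ), P = {x | ∀ e, a e ⬝ᵥ x ≤ b e}

/-- Controllability of a pair `(A, B)`: the columns of `B, A B, …, A ^ (d - 1) B` span the state
space. -/
def IsControllablePair {d p : ℕ} (A : Matrix (Fin d) (Fin d) ℝ) (B : Matrix (Fin d) (Fin p) ℝ) :
    Prop :=
  (⨆ k : Fin d, LinearMap.range (A ^ (k : ℕ) * B).mulVecLin) = ⊤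

/-- A real square matrix is Schur if all its complex eigenvalues lie in the open unit disc. -/
def IsSchurMatrix {d : ℕ} (A : Matrix (Fin d) (Fin d) ℝ) : Prop :=
  ∀ μ ∈ spectrum ℂ (A.map (fun r : ℝ => (r : ℂ))), ‖μ‖ < 1

/-- The data of a network of coupled piecewise affine subsystems, of the model predictive
controller and of the switching ADMM procedure. -/
structure PWANetwork where
  /-- number of subsystems -/
  M : ℕ
  /-- state dimensions -/
  n : Fin M → ℕ
  /-- input dimensions -/
  m : Fin M → ℕ
  /-- neighborhoods: `j ∈ nbr i` if subsystem `j` affects subsystem `i` -/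
  nbr : Fin M → Finset (Fin M)
  /-- local state constraint sets -/
  X : ∀ i, Set (Fin (n i) → ℝ)
  /-- local input constraint sets -/
  U : ∀ i, Set (Fin (m i) → ℝ)
  /-- numbers of regions -/
  L : Fin M → ℕ
  /-- regions -/
  P : ∀ i, Fin (L i) → Set (Fin (n i) → ℝ)
  A : ∀ i, Fin (L i) → Matrix (Fin (n i)) (Fin (n i)) ℝ
  B : ∀ i, Fin (L i) → Matrix (Fin (n i)) (Fin (m i)) ℝ
  c : ∀ i, Fin (L i) → Fin (n i) → ℝ
  /-- coupling matrices; only those with `j ∈ nbr i` are used -/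
  Ac : ∀ i j, Fin (L i) → Matrix (Fin (n i)) (Fin (n j)) ℝ
  /-- numbers of rows of the coupled inequality constraints -/
  q : Fin M → ℕ
  H : ∀ i, Matrix (Fin (q i)) (Fin (n i)) ℝ
  Hc : ∀ i j, Matrix (Fin (q i)) (Fin (n j)) ℝ
  b : ∀ i, Fin (q i) → ℝ
  /-- prediction horizon -/
  N : ℕ
  /-- cost matrices -/
  Q : ∀ i, Matrix (Fin (n i)) (Fin (n i)) ℝ
  R : ∀ i, Matrix (Fin (m i)) (Fin (m i)) ℝ
  Qc : Fin M → ∀ j, Matrix (Fin (n j)) (Fin (n j)) ℝ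
  Phi : ∀ i, Matrix (Fin (n i)) (Fin (n i)) ℝ
  /-- terminal gains -/
  K : ∀ i, Fin (L i) → Matrix (Fin (m i)) (Fin (n i)) ℝ
  /-- local terminal sets -/
  XT : ∀ i, Set (Fin (n i) → ℝ)
  /-- ADMM penalty parameter -/
  rho : ℝ
  /-- number of ADMM iterations after which the switching sequences are frozen -/
  Tcut : ℕ

namespace PWANetwork

variable (S : PWANetwork)

/-! ### Variables -/

/-- The neighbors of subsystem `i`. -/
abbrev Nb (i : Fin S.M) : Type := {j : Fin S.M // j ∈ S.nbr i}

/-- Global states. -/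
abbrev State : Type := ∀ i, Fin (S.n i) → ℝ

/-- Global inputs. -/
abbrev Input : Type := ∀ i, Fin (S.m i) → ℝ

/-- State trajectories of subsystem `i` over the times `0, …, N`. -/
abbrev Traj (i : Fin S.M) : Type := Fin (S.N + 1) → Fin (S.n i) → ℝ

/-- Input sequences of subsystem `i` over the times `0, …, N - 1`. -/
abbrev InputSeq (i : Fin S.M) : Type := Fin S.N → Fin (S.m i) → ℝ

/-- Augmented trajectories: own trajectory and copies of the trajectories of the neighbors. -/
abbrev AugTraj (i : Fin S.M) : Type := S.Traj i × (∀ j : S.Nb i, S.Traj j)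

/-- Local decision variables: augmented trajectory and input sequence. -/
abbrev LocalVar (i : Fin S.M) : Type := S.AugTraj i × S.InputSeq i

/-- Global decision variables. -/
abbrev Var : Type := ∀ i, S.LocalVar i

/-- Local switching sequences over the times `0, …, N`. -/
abbrev Switching (i : Fin S.M) : Type := Fin (S.N + 1) → Fin (S.L i)

variable {S}

/-- The own trajectory in a local variable. -/
abbrev own {i : Fin S.M} (y : S.LocalVar i) : S.Traj i := y.1.1

/-- The copy of the trajectory of the neighbor `j` in a local variable. -/
abbrev copy {i : Fin S.M} (y : S.LocalVar i) (j : S.Nb i) : S.Traj j := y.1.2 j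

/-- The input sequence in a local variable. -/
abbrev inp {i : Fin S.M} (y : S.LocalVar i) : S.InputSeq i := y.2

variable (S)

/-! ### Dynamics -/

/-- The affine state update of subsystem `i` attached to its region `l`. -/
def piece (i : Fin S.M) (l : Fin (S.L i)) (xi : Fin (S.n i) → ℝ) (ui : Fin (S.m i) → ℝ)
    (xj : ∀ j : S.Nb i, Fin (S.n j) → ℝ) : Fin (S.n i) → ℝ :=
  S.A i l *ᵥ xi + S.B i l *ᵥ ui + S.c i l + ∑ j : S.Nb i, S.Ac i j l *ᵥ xj j

/-- The piecewise affine dynamics: `xi'` is a successor of `xi` if it is given by the state update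
of a region that contains `xi`. On a common boundary of several regions each of their updates is
a successor. -/
def Next (i : Fin S.M) (xi : Fin (S.n i) → ℝ) (ui : Fin (S.m i) → ℝ)
    (xj : ∀ j : S.Nb i, Fin (S.n j) → ℝ) (xi' : Fin (S.n i) → ℝ) : Prop :=
  ∃ l, xi ∈ S.P i l ∧ xi' = S.piece i l xi ui xj

/-- The coupled inequality constraint `h_i ≤ 0`. -/
def Coupled (i : Fin S.M) (xi : Fin (S.n i) → ℝ) (xj : ∀ j : S.Nb i, Fin (S.n j) → ℝ) : Prop :=
  S.H i *ᵥ xi + ∑ j : S.Nb i, S.Hc i j *ᵥ xj j ≤ S.b i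

/-! ### Costs -/

/-- Stage cost. -/
def stageCost (i : Fin S.M) (xi : Fin (S.n i) → ℝ) (ui : Fin (S.m i) → ℝ)
    (xj : ∀ j : S.Nb i, Fin (S.n j) → ℝ) : ℝ :=
  xi ⬝ᵥ (S.Q i *ᵥ xi) + ui ⬝ᵥ (S.R i *ᵥ ui) + ∑ j : S.Nb i, xj j ⬝ᵥ (S.Qc i j *ᵥ xj j)

/-- Terminal cost. -/
def termCost (i : Fin S.M) (xi : Fin (S.n i) → ℝ) : ℝ := xi ⬝ᵥ (S.Phi i *ᵥ xi)

/-- The local cost `F_i`. -/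
def cost (i : Fin S.M) (y : S.LocalVar i) : ℝ :=
  (∑ k : Fin S.N, S.stageCost i (own y k.castSucc) (inp y k) (fun j => copy y j k.castSucc))
    + S.termCost i (own y (Fin.last S.N))

/-! ### Feasible sets, with terminal constraints -/

/-- The global terminal set. -/
def terminalSet : Set S.State := {x | ∀ i, x i ∈ S.XT i}

/-- The local constraints that do not depend on a switching sequence. -/
def localSet (i : Fin S.M) (xi : Fin (S.n i) → ℝ) : Set (S.LocalVar i) :=
  {y | (∀ k, S.Coupled i (own y k) (fun j => copy y j k)) ∧
       (∀ k, own y k ∈ S.X i) ∧ (∀ k, inp y k ∈ S.U i) ∧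
       own y 0 = xi ∧ own y (Fin.last S.N) ∈ S.XT i}

/-- The local constraints that depend on the switching sequence. -/
def switchSet (i : Fin S.M) (s : S.Switching i) : Set (S.LocalVar i) :=
  {y | (∀ k : Fin S.N, own y k.succ =
          S.piece i (s k.castSucc) (own y k.castSucc) (inp y k) (fun j => copy y j k.castSucc)) ∧
       (∀ k, own y k ∈ S.P i (s k))}

/-- Consistency between the trajectories and their copies. -/
def Consistent (y : S.Var) : Prop :=
  ∀ (i : Fin S.M) (j : S.Nb i), copy (y i) j = own (y j)

/-- The feasible set of the distributed problem `P_d(x)`. -/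
def feasibleSet (x : S.State) : Set S.Var :=
  {y | (∀ i, y i ∈ S.localSet i (x i)) ∧
       (∀ (i : Fin S.M) (k : Fin S.N), S.Next i (own (y i) k.castSucc) (inp (y i) k)
          (fun j => copy (y i) j k.castSucc) (own (y i) k.succ)) ∧
       S.Consistent y}

/-- The feasible set of the problem `P_s(x)` for a global switching sequence `s`. -/
def feasibleSetOf (s : ∀ i, S.Switching i) (x : S.State) : Set S.Var :=
  {y | (∀ i, y i ∈ S.localSet i (x i) ∩ S.switchSet i (s i)) ∧ S.Consistent y}

/-- The set `X_0` of states for which `P_d(x)` is feasible. -/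
def feasibleStates : Set S.State := {x | (S.feasibleSet x).Nonempty}

/-! ### Rollouts and generated switching sequences -/

/-- `y` is a rollout of the input sequences `v` along the network dynamics from the state `x`
(distributed rollout: the copies are the transmitted true states). -/
def IsRollout (x : S.State) (v : ∀ i, S.InputSeq i) (y : S.Var) : Prop :=
  (∀ i, inp (y i) = v i) ∧ (∀ i, own (y i) 0 = x i) ∧ S.Consistent y ∧
  ∀ (i : Fin S.M) (k : Fin S.N), S.Next i (own (y i) k.castSucc) (inp (y i) k)
    (fun j => copy (y i) j k.castSucc) (own (y i) k.succ)

/-- The switching sequences that subsystem `i` generates by rolling out and branching its dynamics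
from `xi` under given inputs and given copies of the trajectories of its neighbors. -/
def evalSwitching (i : Fin S.M) (xi : Fin (S.n i) → ℝ) (ui : S.InputSeq i)
    (xj : ∀ j : S.Nb i, S.Traj j) : Set (S.Switching i) :=
  {s | ∃ ξ : S.Traj i, ξ 0 = xi ∧ (∀ k, ξ k ∈ closure (S.P i (s k))) ∧
        ∀ k : Fin S.N, ξ k.succ =
          S.piece i (s k.castSucc) (ξ k.castSucc) (ui k) (fun j => xj j k.castSucc)}

/-- The input sequences `v` are weakly feasible for `x`: the rollout of `v` generates a global
switching sequence `s` for which `P_s(x)` is feasible. -/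
def WeaklyFeasible (x : S.State) (v : ∀ i, S.InputSeq i) : Prop :=
  ∃ y, S.IsRollout x v y ∧ ∃ s : ∀ i, S.Switching i,
    (∀ i, s i ∈ S.evalSwitching i (x i) (v i) (copy (y i))) ∧ (S.feasibleSetOf s x).Nonempty

/-! ### Switching ADMM -/

/-- Euclidean inner product of augmented trajectories. -/
def augInner {i : Fin S.M} (v w : S.AugTraj i) : ℝ :=
  (∑ k, v.1 k ⬝ᵥ w.1 k) + ∑ j : S.Nb i, ∑ k, v.2 j k ⬝ᵥ w.2 j k

/-- The components of `z` that are relevant for subsystem `i`. -/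
def augOf (z : ∀ i, S.Traj i) (i : Fin S.M) : S.AugTraj i := (z i, fun j => z j)

/-- The objective of the local minimization: local cost, multiplier term and penalty. -/
noncomputable def augLagrangian (i : Fin S.M) (lam zi : S.AugTraj i) (y : S.LocalVar i) : ℝ :=
  S.cost i y + S.augInner lam y.1 + S.rho / 2 * S.augInner (y.1 - zi) (y.1 - zi)

/-- The average of the trajectory of subsystem `i` and of all copies of it. The copies are held by
the subsystems `j` with `i ∈ nbr j`. -/
noncomputable def average (y : S.Var) (i : Fin S.M) : S.Traj i :=
  ((Fintype.card {j : Fin S.M // i ∈ S.nbr j} : ℝ) + 1)⁻¹ •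
    (own (y i) + ∑ j : {j : Fin S.M // i ∈ S.nbr j}, copy (y j) ⟨i, j.2⟩)

/-- `(s, y, z, lam)` are the iterates of the switching ADMM procedure, run without a bound on the
number of iterations, at the state `x` with initial guess `v` and initial copies taken from
`ydr`. The value `y 0` is not used. -/
structure IsSwADMM (x : S.State) (v : ∀ i, S.InputSeq i) (ydr : S.Var)
    (s : ℕ → ∀ i, S.Switching i) (y : ℕ → S.Var) (z : ℕ → ∀ i, S.Traj i)
    (lam : ℕ → ∀ i, S.AugTraj i) : Prop where
  z_zero : z 0 = 0
  lam_zero : lam 0 = 0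
  s_zero : ∀ i, s 0 i ∈ S.evalSwitching i (x i) (v i) (copy (ydr i))
  y_mem : ∀ τ i, y (τ + 1) i ∈ S.localSet i (x i) ∩ S.switchSet i (s τ i)
  y_min : ∀ τ i, ∀ w ∈ S.localSet i (x i) ∩ S.switchSet i (s τ i),
    S.augLagrangian i (lam τ i) (S.augOf (z τ) i) (y (τ + 1) i) ≤
      S.augLagrangian i (lam τ i) (S.augOf (z τ) i) w
  z_succ : ∀ τ i, z (τ + 1) i = S.average (y (τ + 1)) i
  lam_succ : ∀ τ i,
    lam (τ + 1) i = lam τ i + S.rho • ((y (τ + 1) i).1 - S.augOf (z (τ + 1)) i)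
  s_switch : ∀ τ < S.Tcut, ∀ i,
    (S.evalSwitching i (x i) (inp (y (τ + 1) i)) (copy (y (τ + 1) i)) \ {s τ i}).Nonempty →
      s (τ + 1) i ∈
        S.evalSwitching i (x i) (inp (y (τ + 1) i)) (copy (y (τ + 1) i)) \ {s τ i}
  s_keep : ∀ τ < S.Tcut, ∀ i,
    ¬ (S.evalSwitching i (x i) (inp (y (τ + 1) i)) (copy (y (τ + 1) i)) \ {s τ i}).Nonempty →
      s (τ + 1) i = s τ i
  s_frozen : ∀ τ, S.Tcut ≤ τ → s (τ + 1) = s τ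

/-- `yout` is an output of the switching ADMM procedure when the number of iterations tends to
infinity: an accumulation point of the iterates (their limit, if they converge). -/
def IsSwADMMOutput (x : S.State) (v : ∀ i, S.InputSeq i) (ydr yout : S.Var) : Prop :=
  ∃ s y z lam, S.IsSwADMM x v ydr s y z lam ∧ MapClusterPt yout atTop y

/-! ### The stabilizing distributed controller -/

open Classical in
/-- The cost of subsystem `i` in a rollout `ydr`, with the convention that the value of a rollout
that violates a constraint of `P_d(x)` is infinite. -/
noncomputable def rolloutCost (x : S.State) (ydr : S.Var) (i : Fin S.M) : EReal :=
  if ydr ∈ S.feasibleSet x then ((S.cost i (ydr i) : ℝ) : EReal) else ⊤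

/-- One optimization step at the state `x` with the guess `v`: roll out the guess, run the
switching ADMM procedure, and fall back to the rollout if the result does not improve on it. -/
def OptStep (x : S.State) (v : ∀ i, S.InputSeq i) (y : S.Var) : Prop :=
  ∃ ydr yout, S.IsRollout x v ydr ∧ S.IsSwADMMOutput x v ydr yout ∧
    ((∀ i, ((S.cost i (yout i) : ℝ) : EReal) ≤ S.rolloutCost x ydr i) → y = yout) ∧
    (¬ (∀ i, ((S.cost i (yout i) : ℝ) : EReal) ≤ S.rolloutCost x ydr i) → y = ydr)

/-- `v` is the previous solution `y`, shifted by one time step, with the terminal controller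
appended. -/
def IsShiftedGuess (y : S.Var) (v : ∀ i, S.InputSeq i) : Prop :=
  ∀ i, ∃ l, own (y i) (Fin.last S.N) ∈ S.P i l ∧ ∀ k : Fin S.N,
    v i k = if h : (k : ℕ) + 1 < S.N then inp (y i) ⟨(k : ℕ) + 1, h⟩
      else S.K i l *ᵥ own (y i) (Fin.last S.N)

/-- The closed loop over the time steps `0, …, T - 1`: states `x`, guesses `v`, stored solutions
`y` and applied inputs `u`. The guess `v 0` of the first time step is given from outside. -/
structure IsClosedLoop (T : ℕ) (x : ℕ → S.State) (v : ℕ → ∀ i, S.InputSeq i) (y : ℕ → S.Var)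
    (u : ℕ → S.Input) : Prop where
  /-- inside the terminal set the terminal controllers are applied -/
  terminal : ∀ t < T, x t ∈ S.terminalSet →
    ∀ i, ∃ l, x t i ∈ S.P i l ∧ u t i = S.K i l *ᵥ x t i
  /-- and the stored solution is left unchanged -/
  stored : ∀ t, t + 1 < T → x (t + 1) ∈ S.terminalSet → y (t + 1) = y t
  guess : ∀ t, t + 1 < T → x (t + 1) ∉ S.terminalSet → S.IsShiftedGuess (y t) (v (t + 1))
  optimize : ∀ t < T, x t ∉ S.terminalSet → S.OptStep (x t) (v t) (y t)
  apply_first : ∀ t < T, x t ∉ S.terminalSet →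
    ∀ i (h : 0 < S.N), u t i = inp (y t i) ⟨0, h⟩
  plant : ∀ t < T, ∀ i, S.Next i (x t i) (u t i) (fun j => x t j) (x (t + 1) i)

/-- The state update of the network is unambiguous at the state `x` under the input `u`: if a local
state lies in several regions, then their state updates agree there. -/
def UnambiguousAt (x : S.State) (u : S.Input) : Prop :=
  ∀ i l l', x i ∈ S.P i l → x i ∈ S.P i l' →
    S.piece i l (x i) (u i) (fun j => x j) = S.piece i l' (x i) (u i) (fun j => x j)

/-! ### Assumptions -/

/-- Standing assumptions on the network, the horizon and the penalty parameter. -/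
structure Standing : Prop where
  nbr_irrefl : ∀ i, i ∉ S.nbr i
  X_convex : ∀ i, Convex ℝ (S.X i)
  U_convex : ∀ i, Convex ℝ (S.U i)
  U_closed : ∀ i, IsClosed (S.U i)
  P_polyhedron : ∀ i l, IsPolyhedron (S.P i l)
  P_interior : ∀ i l l', l ≠ l' → interior (S.P i l) ∩ interior (S.P i l') = ∅
  P_cover : ∀ i, (⋃ l, S.P i l) = S.X i
  N_pos : 0 < S.N
  rho_pos : 0 < S.rho

/-- No global switching sequence has an infeasible problem `P_s(x)` although all its local
constraint sets are non-empty. -/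
def SwitchingAssumption : Prop :=
  ∀ x ∈ S.feasibleStates, ¬ ∃ s : ∀ i, S.Switching i,
    S.feasibleSetOf s x = ∅ ∧ ∀ i, (S.localSet i (x i) ∩ S.switchSet i (s i)).Nonempty

/-- The regions of subsystem `i` that contain or touch the origin. -/
def originRegions (i : Fin S.M) : Set (Fin (S.L i)) := {l | (0 : Fin (S.n i) → ℝ) ∈ closure (S.P i l)}

/-- Controllability with stabilizing gains, and the origin is an equilibrium. -/
structure SystemAssumption : Prop where
  controllable : ∀ i l, IsControllablePair (S.A i l) (S.B i l)
  schur : ∀ i l, IsSchurMatrix (S.A i l + S.B i l * S.K i l)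
  equilibrium : ∀ i, ∀ l ∈ S.originRegions i, S.c i l = 0

/-- The local terminal sets are closed convex sets around the origin, invariant under the terminal
controllers whenever the neighbors are in their terminal sets, and compatible with the
constraints. -/
structure TerminalAssumption : Prop where
  closed : ∀ i, IsClosed (S.XT i)
  convex : ∀ i, Convex ℝ (S.XT i)
  zero_mem : ∀ i, (0 : Fin (S.n i) → ℝ) ∈ S.XT i
  subset : ∀ i, S.XT i ⊆ ⋃ l ∈ S.originRegions i, S.P i l
  input_mem : ∀ i, ∀ xi ∈ S.XT i, ∀ l, xi ∈ S.P i l → S.K i l *ᵥ xi ∈ S.U i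
  invariant : ∀ i, ∀ xi ∈ S.XT i, ∀ xj : ∀ j : S.Nb i, Fin (S.n j) → ℝ,
    (∀ j : S.Nb i, xj j ∈ S.XT j) → ∀ l, xi ∈ S.P i l →
      S.piece i l xi (S.K i l *ᵥ xi) xj ∈ S.XT i
  coupled : ∀ x ∈ S.terminalSet, ∀ i, S.Coupled i (x i) (fun j => x j)

/-- Convex quadratic costs, and decrease of the terminal cost on the terminal set. -/
structure LyapunovAssumption : Prop where
  Q_posDef : ∀ i, (S.Q i).PosDef
  R_posDef : ∀ i, (S.R i).PosDef
  Phi_posDef : ∀ i, (S.Phi i).PosDef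
  Qc_posSemidef : ∀ i, ∀ j ∈ S.nbr i, (S.Qc i j).PosSemidef
  decrease : ∀ x ∈ S.terminalSet, ∀ l : ∀ i, Fin (S.L i), (∀ i, x i ∈ S.P i (l i)) →
    ∑ i, (S.termCost i (S.piece i (l i) (x i) (S.K i (l i) *ᵥ x i) (fun j => x j))
      - S.termCost i (x i)
      + S.stageCost i (x i) (S.K i (l i) *ᵥ x i) (fun j => x j)) ≤ 0

end PWANetwork

/-!
Once the switching sequences are frozen, the procedure is consensus ADMM for a convex problem, which
is feasible by the assumption on the local problems. Nothing guarantees a dual solution, so the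
usual Lyapunov function, the distance to a saddle point, is not available. Comparing two consecutive
iterates eliminates the multiplier instead: the squared residual plus the squared consensus step
decreases by at least a fixed multiple of the squared step. The steps are therefore summable, which
makes the Lagrangian monotone up to a summable error. It is also bounded above by comparison with a
feasible point, so the residuals tend to zero and the costs stay bounded. As the cost is positive
definite modulo consensus, the iterates accumulate, and only at feasible points.

The solution applied by the controller is then always feasible. Dropping its first step and
appending a step of the terminal controllers yields a feasible point at the next state.
-/

section RealSequences

theorem tendsto_zero_of_le_sub {a ψ : ℕ → ℝ} (ha : ∀ n, 0 ≤ a n)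
    (hstep : ∀ n, a n ≤ ψ (n + 1) - ψ n) (hψ : BddAbove (Set.range ψ)) :
    Tendsto a atTop (𝓝 0) := by
  have hmono : Monotone ψ := monotone_nat_of_le_succ fun n =>
    sub_nonneg.1 ((ha n).trans (hstep n))
  have hlim := tendsto_atTop_ciSup hmono hψ
  refine squeeze_zero ha hstep ?_
  simpa only [sub_self, Function.comp_def] using (hlim.comp (tendsto_add_atTop_nat 1)).sub hlim

theorem bounded_and_tendsto_zero_of_dissipation {a b φ e : ℕ → ℝ} {α ρ K₀ K₁ : ℝ}
    (ha : ∀ n, 0 ≤ a n) (hb : ∀ n, 0 ≤ b n) (he : ∀ n, 0 ≤ e n)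
    (hα : 0 < α) (hρ : 0 < ρ) (hK₁ : 0 ≤ K₁)
    (hdiss : ∀ n, a (n + 1) + b (n + 1) + α * b (n + 1) ≤ a n + b n)
    (hincr : ∀ n, φ n + ρ * a (n + 1) - ρ / 2 * (b n + b (n + 1)) ≤ φ (n + 1))
    (hupper : ∀ n, φ n + e n / 2 ≤ K₀ + K₁ * (a n + b n)) :
    BddAbove (Set.range e) ∧ Tendsto a atTop (𝓝 0) := by
  have hanti : Antitone fun n => a n + b n := antitone_nat_of_succ_le fun n => by
    linarith [hdiss n, mul_nonneg hα.le (hb (n + 1))]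
  -- Subtracting the dissipated energy and half a step turns the almost monotone `φ` into a
  -- monotone sequence.
  set ψ : ℕ → ℝ := fun n => φ n - ρ / α * (a n + b n) - ρ / 2 * b n with hψ
  have hstep : ∀ n, ρ * a (n + 1) ≤ ψ (n + 1) - ψ n := fun n => by
    have h := mul_le_mul_of_nonneg_left (hdiss n) (div_pos hρ hα).le
    have hcancel : ρ / α * (α * b (n + 1)) = ρ * b (n + 1) := by field_simp
    simp only [hψ]
    linarith [hincr n]
  have hmono : Monotone ψ := monotone_nat_of_le_succ fun n => by
    linarith [hstep n, mul_nonneg hρ.le (ha (n + 1))]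
  have hψe : ∀ n, ψ n + e n / 2 ≤ K₀ + K₁ * (a 0 + b 0) := fun n => by
    have h₁ := mul_nonneg (div_pos hρ hα).le (add_nonneg (ha n) (hb n))
    have h₂ := mul_nonneg hρ.le (hb n)
    have h₃ := mul_le_mul_of_nonneg_left (hanti n.zero_le) hK₁
    simp only [hψ]
    linarith [hupper n]
  constructor
  · refine ⟨2 * (K₀ + K₁ * (a 0 + b 0) - ψ 0), ?_⟩
    rintro _ ⟨n, rfl⟩
    linarith [hψe n, hmono n.zero_le]
  · have hbdd : BddAbove (Set.range ψ) := by
      refine ⟨K₀ + K₁ * (a 0 + b 0), ?_⟩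
      rintro _ ⟨n, rfl⟩
      linarith [hψe n, he n]
    have hlim := tendsto_zero_of_le_sub (fun n => mul_nonneg hρ.le (ha (n + 1))) hstep hbdd
    rw [← tendsto_add_atTop_iff_nat 1]
    simpa [hρ.ne'] using hlim.const_mul ρ⁻¹

end RealSequences

section QuadraticForms

theorem nonneg_of_forall_add_mul_nonneg {l c : ℝ} (h : ∀ t, 0 < t → t ≤ 1 → 0 ≤ l + t * c) :
    0 ≤ l := by
  have hcont : Continuous fun t : ℝ => l + t * c := by fun_prop
  have hlim : Tendsto (fun t : ℝ => l + t * c) (𝓝[>] 0) (𝓝 l) :=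
    (hcont.tendsto' 0 l (by simp)).mono_left nhdsWithin_le_nhds
  refine ge_of_tendsto hlim ?_
  filter_upwards [Ioc_mem_nhdsGT zero_lt_one] with t ht using h t ht.1 ht.2

theorem exists_le_mul_of_homogeneous {V : Type*} [NormedAddCommGroup V] [NormedSpace ℝ V]
    [FiniteDimensional ℝ V] {k : ℕ} (hk : k ≠ 0) {f g : V → ℝ}
    (hf : Continuous f) (hg : Continuous g)
    (hf_smul : ∀ (t : ℝ) v, f (t • v) = t ^ k * f v)
    (hg_smul : ∀ (t : ℝ) v, g (t • v) = t ^ k * g v) (hg_pos : ∀ v, v ≠ 0 → 0 < g v) :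
    ∃ c, 0 < c ∧ ∀ v, f v ≤ c * g v := by
  have : ProperSpace V := FiniteDimensional.proper_real V
  have hg_sphere : ∀ v ∈ Metric.sphere (0 : V) 1, 0 < g v := fun v hv =>
    hg_pos v (ne_zero_of_mem_unit_sphere ⟨v, hv⟩)
  obtain ⟨C, hC⟩ := (isCompact_sphere (0 : V) 1).bddAbove_image
    (hf.continuousOn.div hg.continuousOn fun v hv => (hg_sphere v hv).ne')
  refine ⟨max C 1, by positivity, fun v => ?_⟩
  rcases eq_or_ne v 0 with rfl | hv
  · have hf₀ : f 0 = 0 := by simpa [hk] using hf_smul 0 0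
    have hg₀ : g 0 = 0 := by simpa [hk] using hg_smul 0 0
    rw [hf₀, hg₀, mul_zero]
  have hunit : ‖v‖⁻¹ • v ∈ Metric.sphere (0 : V) 1 := by simp [norm_smul, hv]
  have hle : f (‖v‖⁻¹ • v) ≤ max C 1 * g (‖v‖⁻¹ • v) :=
    (div_le_iff₀ (hg_sphere _ hunit)).1
      ((hC (Set.mem_image_of_mem _ hunit)).trans (le_max_left C 1))
  rw [hf_smul, hg_smul, mul_left_comm] at hle
  exact le_of_mul_le_mul_left hle (pow_pos (inv_pos.2 (norm_pos_iff.2 hv)) k)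

theorem quadraticForm_add_smul_sub {V : Type*} [AddCommGroup V] [Module ℝ V]
    (F : QuadraticForm ℝ V) (v w : V) (t : ℝ) :
    F (v + t • (w - v)) = (1 - t) * F v + t * F w - t * (1 - t) * F (w - v) := by
  have hsegment := QuadraticMap.map_add F v (t • (w - v))
  have hend := QuadraticMap.map_add F v (w - v)
  rw [add_sub_cancel] at hend
  rw [F.map_smul, QuadraticMap.polar_smul_right, smul_eq_mul, smul_eq_mul] at hsegment
  rw [hsegment]
  linear_combination (-t) * hend

variable {V : Type*} [NormedAddCommGroup V] [NormedSpace ℝ V] [FiniteDimensional ℝ V]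

theorem continuous_quadraticForm (Q : QuadraticForm ℝ V) : Continuous Q := by
  have hassoc : ⇑Q = fun v =>
      (QuadraticMap.associated (R := ℝ) Q).toContinuousBilinearMap v v :=
    funext fun v => (QuadraticMap.associated_eq_self_apply ℝ Q v).symm
  rw [hassoc]
  fun_prop

theorem exists_quadraticForm_le_mul (Q' : QuadraticForm ℝ V) {Q : QuadraticForm ℝ V}
    (hQ : Q.PosDef) : ∃ c, 0 < c ∧ ∀ v, Q' v ≤ c * Q v :=
  exists_le_mul_of_homogeneous two_ne_zero (continuous_quadraticForm Q')
    (continuous_quadraticForm Q) (fun t v => by rw [Q'.map_smul, smul_eq_mul, sq])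
    (fun t v => by rw [Q.map_smul, smul_eq_mul, sq]) hQ

theorem exists_norm_sq_le_mul {Q : QuadraticForm ℝ V} (hQ : Q.PosDef) :
    ∃ c, 0 < c ∧ ∀ v, ‖v‖ ^ 2 ≤ c * Q v :=
  exists_le_mul_of_homogeneous two_ne_zero (by fun_prop) (continuous_quadraticForm Q)
    (fun t v => by rw [norm_smul, mul_pow, Real.norm_eq_abs, sq_abs])
    (fun t v => by rw [Q.map_smul, smul_eq_mul, sq]) hQ

end QuadraticForms

section ConsensusADMM

variable {V E : Type*} [AddCommGroup V] [Module ℝ V] [AddCommGroup E] [Module ℝ E]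

/-- The augmented Lagrangian of the problem of minimizing `F v` subject to `π v = ζ`, with
multiplier `lam` and penalty parameter `ρ`. The inner product of the coupled variables is an
arbitrary bilinear form `B`. -/
noncomputable def augmentedLagrangian (B : LinearMap.BilinForm ℝ E) (π : V →ₗ[ℝ] E)
    (F : QuadraticForm ℝ V) (ρ : ℝ) (lam ζ : E) (v : V) : ℝ :=
  F v + B lam (π v) + ρ / 2 * B (π v - ζ) (π v - ζ)

/-- The iterates of consensus ADMM for minimizing `F` over the points `v` of `C` with `r v = 0`.
The coupled variables of `v` are `p v + r v`, where `p v` is their projection onto the consensus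
subspace and `r v` is the residual, so the averaging step is built into the penalty center
`p (y n)`. The initial multiplier is only required to be orthogonal to the consensus subspace. -/
structure IsConsensusADMM (B : LinearMap.BilinForm ℝ E) (p r : V →ₗ[ℝ] E) (F : QuadraticForm ℝ V)
    (C : Set V) (ρ : ℝ) (y : ℕ → V) (lam : ℕ → E) : Prop where
  mem : ∀ n, y n ∈ C
  isMinOn : ∀ n, IsMinOn (augmentedLagrangian B (p + r) F ρ (lam n) (p (y n))) C (y (n + 1))
  lam_zero : ∀ v, B (lam 0) (p v) = 0
  lam_succ : ∀ n, lam (n + 1) = lam n + ρ • r (y (n + 1))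

variable {B : LinearMap.BilinForm ℝ E} {p r : V →ₗ[ℝ] E} {F : QuadraticForm ℝ V} {C : Set V}
  {ρ : ℝ} {y : ℕ → V} {lam : ℕ → E}

theorem two_mul_bilin_le (hB : B.IsPosSemidef) (a b : E) : 2 * B a b ≤ B a a + B b b := by
  have h := hB.nonneg (a - b)
  simp only [map_sub, LinearMap.sub_apply] at h
  linarith [hB.eq a b]

theorem quadratic_growth_of_isMinOn_augmentedLagrangian (hB : B.IsSymm) {π : V →ₗ[ℝ] E}
    (hC : Convex ℝ C) {lam ζ : E} {v w : V} (hv : v ∈ C) (hw : w ∈ C)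
    (hmin : IsMinOn (augmentedLagrangian B π F ρ lam ζ) C v) :
    F v + F (w - v) ≤ F w + B (lam + ρ • (π v - ζ)) (π (w - v)) := by
  suffices 0 ≤ F w - F v - F (w - v) + B (lam + ρ • (π v - ζ)) (π (w - v)) by linarith
  -- The directional derivative at the minimizer `v` towards `w` is nonnegative.
  apply nonneg_of_forall_add_mul_nonneg
    (c := F (w - v) + ρ / 2 * B (π (w - v)) (π (w - v)))
  intro t ht ht₁
  have hle := isMinOn_iff.1 hmin _ (hC.add_smul_sub_mem hv hw ⟨ht.le, ht₁⟩)
  have hπ : π (v + t • (w - v)) - ζ = (π v - ζ) + t • π (w - v) := by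
    rw [map_add, map_smul]
    abel
  simp only [augmentedLagrangian] at hle
  rw [quadraticForm_add_smul_sub, hπ, map_add π v, map_smul π t] at hle
  have hsymm := hB.eq (π (w - v)) (π v - ζ)
  generalize π (w - v) = d at *
  generalize π v - ζ = q at *
  simp only [map_add, map_smul, LinearMap.add_apply, LinearMap.smul_apply, smul_eq_mul] at hle ⊢
  rw [hsymm] at hle
  exact nonneg_of_mul_nonneg_right (by linarith) ht

theorem bilin_multiplier_consensus_eq_zero (horth : ∀ v w, B (r v) (p w) = 0)
    (hlam_zero : ∀ v, B (lam 0) (p v) = 0)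
    (hlam_succ : ∀ n, lam (n + 1) = lam n + ρ • r (y (n + 1))) (n : ℕ) (v : V) :
    B (lam n) (p v) = 0 := by
  induction n with
  | zero => exact hlam_zero v
  | succ n ih =>
    rw [hlam_succ, map_add, map_smul, LinearMap.add_apply, LinearMap.smul_apply, ih, horth,
      smul_zero, add_zero]

namespace IsConsensusADMM

theorem variational_inequality (hB : B.IsSymm) (horth : ∀ v w, B (r v) (p w) = 0)
    (hC : Convex ℝ C) (h : IsConsensusADMM B p r F C ρ y lam) (n : ℕ) {w : V} (hw : w ∈ C) :
    F (y (n + 1)) + F (w - y (n + 1)) ≤ F w + B (lam (n + 1)) (r (w - y (n + 1)))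
      + ρ * B (p (y (n + 1) - y n)) (p (w - y (n + 1))) := by
  have hgrowth :=
    quadratic_growth_of_isMinOn_augmentedLagrangian hB hC (h.mem (n + 1)) hw (h.isMinOn n)
  have hgradient : lam n + ρ • ((p + r) (y (n + 1)) - p (y n)) =
      lam (n + 1) + ρ • p (y (n + 1) - y n) := by
    rw [h.lam_succ, LinearMap.add_apply, map_sub]
    module
  have horth' : ∀ v w, B (p v) (r w) = 0 := fun v w => by rw [hB.eq, horth]
  have hlamp := bilin_multiplier_consensus_eq_zero horth h.lam_zero h.lam_succ (n + 1)
  rw [hgradient, LinearMap.add_apply] at hgrowth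
  simp only [map_add B, map_smul B, map_add (B _), LinearMap.add_apply, LinearMap.smul_apply,
    smul_eq_mul, hlamp, horth'] at hgrowth
  linarith

theorem lagrangian_le_succ (hB : B.IsPosSemidef) (horth : ∀ v w, B (r v) (p w) = 0)
    (hF : ∀ v, 0 ≤ F v) (hC : Convex ℝ C) (hρ : 0 < ρ)
    (h : IsConsensusADMM B p r F C ρ y lam) (n : ℕ) :
    F (y (n + 1)) + B (lam (n + 1)) (r (y (n + 1))) + ρ * B (r (y (n + 2))) (r (y (n + 2)))
        - ρ / 2 * (B (p (y (n + 1) - y n)) (p (y (n + 1) - y n))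
          + B (p (y (n + 2) - y (n + 1))) (p (y (n + 2) - y (n + 1)))) ≤
      F (y (n + 2)) + B (lam (n + 2)) (r (y (n + 2))) := by
  have hvar := h.variational_inequality hB.isSymm horth hC n (h.mem (n + 2))
  have hyoung := mul_le_mul_of_nonneg_left
    (two_mul_bilin_le hB (p (y (n + 1) - y n)) (p (y (n + 2) - y (n + 1)))) hρ.le
  have hlam : B (lam (n + 2)) (r (y (n + 2))) =
      B (lam (n + 1)) (r (y (n + 2))) + ρ * B (r (y (n + 2))) (r (y (n + 2))) := by
    rw [h.lam_succ (n + 1), map_add, map_smul, LinearMap.add_apply, LinearMap.smul_apply,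
      smul_eq_mul]
  have hres : B (lam (n + 1)) (r (y (n + 2) - y (n + 1))) =
      B (lam (n + 1)) (r (y (n + 2))) - B (lam (n + 1)) (r (y (n + 1))) := by
    rw [map_sub, map_sub]
  linarith [hF (y (n + 2) - y (n + 1))]

theorem residual_energy_succ_le (hB : B.IsPosSemidef) (horth : ∀ v w, B (r v) (p w) = 0)
    (hC : Convex ℝ C) (hρ : 0 < ρ) (h : IsConsensusADMM B p r F C ρ y lam) (n : ℕ) :
    B (r (y (n + 2))) (r (y (n + 2)))
        + B (p (y (n + 2) - y (n + 1))) (p (y (n + 2) - y (n + 1)))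
        + (B (r (y (n + 2) - y (n + 1))) (r (y (n + 2) - y (n + 1)))
          + 4 / ρ * F (y (n + 2) - y (n + 1))) ≤
      B (r (y (n + 1))) (r (y (n + 1))) + B (p (y (n + 1) - y n)) (p (y (n + 1) - y n)) := by
  have hforth := h.variational_inequality hB.isSymm horth hC n (h.mem (n + 2))
  have hback := h.variational_inequality hB.isSymm horth hC (n + 1) (h.mem (n + 1))
  rw [h.lam_succ (n + 1), ← neg_sub, QuadraticMap.map_neg, show n + 1 + 1 = n + 2 from rfl]
    at hback
  simp only [map_neg, map_add B, map_smul B, LinearMap.add_apply, LinearMap.smul_apply,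
    smul_eq_mul] at hback
  have hpolar : 2 * B (r (y (n + 2))) (r (y (n + 2) - y (n + 1))) =
      B (r (y (n + 2))) (r (y (n + 2))) - B (r (y (n + 1))) (r (y (n + 1)))
        + B (r (y (n + 2) - y (n + 1))) (r (y (n + 2) - y (n + 1))) := by
    simp only [map_sub, LinearMap.sub_apply]
    linarith [hB.eq (r (y (n + 1))) (r (y (n + 2)))]
  have hyoung := two_mul_bilin_le hB (p (y (n + 1) - y n)) (p (y (n + 2) - y (n + 1)))
  -- Adding the two inequalities cancels the unknown multiplier.
  have hsum : 4 / ρ * F (y (n + 2) - y (n + 1))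
      + 2 * B (r (y (n + 2))) (r (y (n + 2) - y (n + 1)))
      + 2 * B (p (y (n + 2) - y (n + 1))) (p (y (n + 2) - y (n + 1)))
      ≤ 2 * B (p (y (n + 1) - y n)) (p (y (n + 2) - y (n + 1))) := by
    refine le_of_mul_le_mul_left ?_ (half_pos hρ)
    have hcancel : ρ / 2 * (4 / ρ * F (y (n + 2) - y (n + 1))) =
        2 * F (y (n + 2) - y (n + 1)) := by
      field_simp
      norm_num
    linarith
  linarith

theorem dissipation (hB : B.IsPosSemidef) (horth : ∀ v w, B (r v) (p w) = 0)
    (hF : ∀ v, 0 ≤ F v) {c : ℝ} (hc : 0 < c)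
    (hcoercive : ∀ v, B (p v) (p v) ≤ c * (F v + B (r v) (r v)))
    (hC : Convex ℝ C) (hρ : 0 < ρ) (h : IsConsensusADMM B p r F C ρ y lam) (n : ℕ) :
    B (r (y (n + 2))) (r (y (n + 2)))
        + B (p (y (n + 2) - y (n + 1))) (p (y (n + 2) - y (n + 1)))
        + min 1 (4 / ρ) / c * B (p (y (n + 2) - y (n + 1))) (p (y (n + 2) - y (n + 1))) ≤
      B (r (y (n + 1))) (r (y (n + 1))) + B (p (y (n + 1) - y n)) (p (y (n + 1) - y n)) := by
  refine le_trans ?_ (h.residual_energy_succ_le hB horth hC hρ n)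
  set Δ := y (n + 2) - y (n + 1)
  have hmin : 0 < min 1 (4 / ρ) := lt_min one_pos (div_pos four_pos hρ)
  have hdecrease :=
    calc min 1 (4 / ρ) / c * B (p Δ) (p Δ)
        ≤ min 1 (4 / ρ) * (F Δ + B (r Δ) (r Δ)) := by
          rw [div_mul_eq_mul_div, div_le_iff₀ hc, mul_assoc, mul_comm _ c]
          exact mul_le_mul_of_nonneg_left (hcoercive Δ) hmin.le
      _ = min 1 (4 / ρ) * B (r Δ) (r Δ) + min 1 (4 / ρ) * F Δ := by ring
      _ ≤ 1 * B (r Δ) (r Δ) + 4 / ρ * F Δ :=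
          add_le_add (mul_le_mul_of_nonneg_right (min_le_left _ _) (hB.nonneg _))
            (mul_le_mul_of_nonneg_right (min_le_right _ _) (hF _))
  linarith

theorem lagrangian_add_half_cost_le (hB : B.IsPosSemidef) (horth : ∀ v w, B (r v) (p w) = 0)
    {c : ℝ} (hc : 0 < c) (hcoercive : ∀ v, B (p v) (p v) ≤ c * (F v + B (r v) (r v)))
    (hC : Convex ℝ C) (h : IsConsensusADMM B p r F C ρ y lam) {w : V} (hw : w ∈ C)
    (hrw : r w = 0) (n : ℕ) :
    F (y (n + 1)) + B (lam (n + 1)) (r (y (n + 1))) + F (w - y (n + 1)) / 2 ≤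
      F w + (ρ ^ 2 * c / 2 + 1 / 2) * (B (r (y (n + 1))) (r (y (n + 1)))
        + B (p (y (n + 1) - y n)) (p (y (n + 1) - y n))) := by
  have hvar := h.variational_inequality hB.isSymm horth hC n hw
  have hcoer := hcoercive (w - y (n + 1))
  have hres : r (w - y (n + 1)) = -r (y (n + 1)) := by rw [map_sub, hrw, zero_sub]
  rw [hres] at hvar hcoer
  simp only [map_neg, LinearMap.neg_apply, neg_neg] at hvar hcoer
  set Δ := y (n + 1) - y n
  set d := w - y (n + 1)
  have hyoung := two_mul_bilin_le hB ((ρ * c) • p Δ) (p d)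
  simp only [map_smul, LinearMap.smul_apply, smul_eq_mul] at hyoung
  have hcross : ρ * B (p Δ) (p d) ≤
      ρ ^ 2 * c / 2 * B (p Δ) (p Δ) + (F d + B (r (y (n + 1))) (r (y (n + 1)))) / 2 := by
    refine le_of_mul_le_mul_left ?_ hc
    linarith
  have hprimal : 0 ≤ ρ ^ 2 * c / 2 * B (r (y (n + 1))) (r (y (n + 1))) :=
    mul_nonneg (by positivity) (hB.nonneg _)
  linarith [hB.nonneg (p Δ)]

theorem bddAbove_cost_and_residual_tendsto (hB : B.IsPosSemidef)
    (horth : ∀ v w, B (r v) (p w) = 0) (hF : ∀ v, 0 ≤ F v) {c : ℝ} (hc : 0 < c)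
    (hcoercive : ∀ v, B (p v) (p v) ≤ c * (F v + B (r v) (r v))) (hC : Convex ℝ C) (hρ : 0 < ρ)
    (h : IsConsensusADMM B p r F C ρ y lam) {w : V} (hw : w ∈ C) (hrw : r w = 0) :
    BddAbove (Set.range fun n => F (w - y (n + 1))) ∧
      Tendsto (fun n => B (r (y n)) (r (y n))) atTop (𝓝 0) := by
  rw [← tendsto_add_atTop_iff_nat 1]
  exact bounded_and_tendsto_zero_of_dissipation
    (b := fun n => B (p (y (n + 1) - y n)) (p (y (n + 1) - y n)))
    (φ := fun n => F (y (n + 1)) + B (lam (n + 1)) (r (y (n + 1))))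
    (fun _ => hB.nonneg _) (fun _ => hB.nonneg _) (fun _ => hF _)
    (div_pos (lt_min one_pos (div_pos four_pos hρ)) hc) hρ (by positivity)
    (h.dissipation hB horth hF hc hcoercive hC hρ) (h.lagrangian_le_succ hB horth hF hC hρ)
    (h.lagrangian_add_half_cost_le hB horth hc hcoercive hC hw hrw)

end IsConsensusADMM

end ConsensusADMM

theorem IsPolyhedron.isClosed {d : ℕ} {P : Set (Fin d → ℝ)} (h : IsPolyhedron P) :
    IsClosed P := by
  obtain ⟨r, a, b, rfl⟩ := h
  simp only [Set.ofPred_forall]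
  exact isClosed_iInter fun e => isClosed_le (by fun_prop) continuous_const

theorem IsPolyhedron.convex {d : ℕ} {P : Set (Fin d → ℝ)} (h : IsPolyhedron P) :
    Convex ℝ P := by
  obtain ⟨r, a, b, rfl⟩ := h
  simp only [Set.ofPred_forall]
  exact convex_iInter fun e => convex_halfSpace_le
    ⟨fun _ _ => dotProduct_add _ _ _, fun _ _ => dotProduct_smul _ _ _⟩ _

namespace PWANetwork

variable (S : PWANetwork)

/-! ### The consensus splitting -/

/-- The Euclidean inner product of families of augmented trajectories, as a bilinear form; it plays
the role of `B` in `IsConsensusADMM`. -/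
def augForm : LinearMap.BilinForm ℝ (∀ i, S.AugTraj i) :=
  LinearMap.mk₂ ℝ (fun v w => ∑ i, S.augInner (v i) (w i))
    (fun v v' w => by
      simp only [augInner, Pi.add_apply, Prod.fst_add, Prod.snd_add, add_dotProduct,
        Finset.sum_add_distrib]
      ring)
    (fun t v w => by
      simp only [augInner, Pi.smul_apply, Prod.smul_fst, Prod.smul_snd, smul_dotProduct,
        ← Finset.smul_sum, ← smul_add])
    (fun v w w' => by
      simp only [augInner, Pi.add_apply, Prod.fst_add, Prod.snd_add, dotProduct_add,
        Finset.sum_add_distrib]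
      ring)
    (fun t v w => by
      simp only [augInner, Pi.smul_apply, Prod.smul_fst, Prod.smul_snd, dotProduct_smul,
        ← Finset.smul_sum, ← smul_add])

theorem augForm_apply (v w : ∀ i, S.AugTraj i) :
    S.augForm v w = ∑ i, S.augInner (v i) (w i) := rfl

theorem augInner_self_nonneg {i : Fin S.M} (v : S.AugTraj i) : 0 ≤ S.augInner v v :=
  add_nonneg (Finset.sum_nonneg fun _ _ => dotProduct_self_star_nonneg _)
    (Finset.sum_nonneg fun _ _ => Finset.sum_nonneg fun _ _ => dotProduct_self_star_nonneg _)

theorem augInner_self_eq_zero {i : Fin S.M} {v : S.AugTraj i} :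
    S.augInner v v = 0 ↔ v = 0 := by
  have hnonneg : ∀ {d : ℕ} (u : Fin d → ℝ), 0 ≤ u ⬝ᵥ u := fun u => dotProduct_self_star_nonneg u
  have hsum : ∀ {d : ℕ} (u : Fin (S.N + 1) → Fin d → ℝ), 0 ≤ ∑ k, u k ⬝ᵥ u k :=
    fun u => Finset.sum_nonneg fun k _ => hnonneg (u k)
  rw [augInner, add_eq_zero_iff_of_nonneg (hsum v.1) (Finset.sum_nonneg fun j _ => hsum (v.2 j)),
    Finset.sum_eq_zero_iff_of_nonneg fun k _ => hnonneg (v.1 k),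
    Finset.sum_eq_zero_iff_of_nonneg fun j _ => hsum (v.2 j)]
  simp only [Finset.sum_eq_zero_iff_of_nonneg fun _ _ => hnonneg _, Finset.mem_univ, true_implies,
    dotProduct_self_eq_zero, Prod.ext_iff, funext_iff, Prod.fst_zero, Prod.snd_zero,
    Pi.zero_apply]

theorem isPosSemidef_augForm : S.augForm.IsPosSemidef where
  eq v w := by simp only [augForm_apply, augInner, dotProduct_comm]
  nonneg v := by
    rw [augForm_apply]
    exact Finset.sum_nonneg fun i _ => S.augInner_self_nonneg (v i)

theorem augForm_self_eq_zero {v : ∀ i, S.AugTraj i} : S.augForm v v = 0 ↔ v = 0 := by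
  rw [augForm_apply, Finset.sum_eq_zero_iff_of_nonneg fun _ _ => S.augInner_self_nonneg _]
  simp only [Finset.mem_univ, true_implies, augInner_self_eq_zero, funext_iff, Pi.zero_apply]

theorem sum_neighbors_comm {α : Type*} [AddCommMonoid α] (f : ∀ i j : Fin S.M, j ∈ S.nbr i → α) :
    ∑ i, ∑ j : S.Nb i, f i j j.2 = ∑ j, ∑ i : {i : Fin S.M // j ∈ S.nbr i}, f i j i.2 := by
  rw [Finset.sum_sigma', Finset.sum_sigma']
  exact Finset.sum_bij' (fun a _ => ⟨a.2.1, a.1, a.2.2⟩) (fun a _ => ⟨a.2.1, a.1, a.2.2⟩)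
    (fun _ _ => Finset.mem_univ _) (fun _ _ => Finset.mem_univ _)
    (fun _ _ => rfl) (fun _ _ => rfl) (fun _ _ => rfl)

theorem augForm_augOf (v : ∀ i, S.AugTraj i) (z : ∀ i, S.Traj i) :
    S.augForm v (S.augOf z) =
      ∑ i, ∑ k, ((v i).1 + ∑ j : {j : Fin S.M // i ∈ S.nbr j}, (v j).2 ⟨i, j.2⟩) k ⬝ᵥ z i k := by
  simp only [augForm_apply, augInner, augOf, Pi.add_apply, add_dotProduct, Finset.sum_add_distrib]
  rw [S.sum_neighbors_comm fun i j hj => ∑ k, (v i).2 ⟨j, hj⟩ k ⬝ᵥ z j k]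
  refine congrArg _ (Finset.sum_congr rfl fun i _ => Finset.sum_comm.trans
    (Finset.sum_congr rfl fun k _ => ?_))
  have happly := Finset.sum_apply (M := fun _ => Fin (S.n i) → ℝ) k Finset.univ
    fun j : {j : Fin S.M // i ∈ S.nbr j} => (v j).2 ⟨i, j.2⟩
  rw [happly, sum_dotProduct]

/-- The averaging step of the switching ADMM procedure, as a linear map. -/
noncomputable def averageMap : S.Var →ₗ[ℝ] ∀ i, S.Traj i where
  toFun := S.average
  map_add' y w := by
    funext i
    simp only [average, copy, own, Pi.add_apply, Prod.fst_add, Prod.snd_add,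
      Finset.sum_add_distrib, ← smul_add]
    congr 1
    abel
  map_smul' t y := by
    funext i
    simp only [average, copy, own, Pi.smul_apply, Prod.smul_fst, Prod.smul_snd,
      ← Finset.smul_sum, ← smul_add, RingHom.id_apply]
    rw [smul_comm]

/-- The consensus part of a global variable: all trajectories and copies are replaced by their
averages. -/
noncomputable def consensusPart : S.Var →ₗ[ℝ] ∀ i, S.AugTraj i :=
  LinearMap.pi (fun i => (LinearMap.proj i).prod (LinearMap.pi fun j => LinearMap.proj j.1))
    ∘ₗ S.averageMap

/-- The consensus residual of a global variable: the deviation of all trajectories and copies from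
their averages. -/
noncomputable def residual : S.Var →ₗ[ℝ] ∀ i, S.AugTraj i :=
  LinearMap.pi (fun i => LinearMap.fst ℝ _ _ ∘ₗ LinearMap.proj i) - S.consensusPart

theorem consensusPart_apply (y : S.Var) : S.consensusPart y = S.augOf (S.average y) := rfl

theorem residual_apply (y : S.Var) (i : Fin S.M) :
    S.residual y i = (y i).1 - S.augOf (S.average y) i := rfl

theorem consensusPart_add_residual_apply (y : S.Var) (i : Fin S.M) :
    (S.consensusPart + S.residual) y i = (y i).1 := by
  rw [LinearMap.add_apply, Pi.add_apply, residual_apply, consensusPart_apply, add_sub_cancel]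

theorem residual_sum_eq_zero (y : S.Var) (i : Fin S.M) :
    (S.residual y i).1 + ∑ j : {j : Fin S.M // i ∈ S.nbr j}, (S.residual y j).2 ⟨i, j.2⟩ = 0 := by
  have haverage : ((Fintype.card {j : Fin S.M // i ∈ S.nbr j} : ℝ) + 1) • S.average y i =
      own (y i) + ∑ j : {j : Fin S.M // i ∈ S.nbr j}, copy (y j) ⟨i, j.2⟩ := by
    rw [average, smul_inv_smul₀ (by positivity)]
  simp only [residual_apply, augOf, Prod.fst_sub, Prod.snd_sub, Pi.sub_apply]
  rw [Finset.sum_sub_distrib, Finset.sum_const, Finset.card_univ, ← Nat.cast_smul_eq_nsmul ℝ,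
    sub_add_sub_comm, ← haverage]
  module

theorem augForm_residual_consensusPart (y w : S.Var) :
    S.augForm (S.residual y) (S.consensusPart w) = 0 := by
  simp only [consensusPart_apply, augForm_augOf, residual_sum_eq_zero, Pi.zero_apply,
    zero_dotProduct, Finset.sum_const_zero]

theorem average_eq_own {y : S.Var} (h : S.Consistent y) (i : Fin S.M) :
    S.average y i = own (y i) := by
  have hcopy : ∀ j : {j : Fin S.M // i ∈ S.nbr j}, copy (y j) ⟨i, j.2⟩ = own (y i) :=
    fun j => h j ⟨i, j.2⟩
  rw [average, Finset.sum_congr rfl fun j _ => hcopy j, Finset.sum_const, Finset.card_univ,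
    ← Nat.cast_smul_eq_nsmul ℝ, inv_smul_eq_iff₀ (by positivity), add_smul, one_smul, add_comm]

theorem residual_eq_zero_iff {y : S.Var} : S.residual y = 0 ↔ S.Consistent y := by
  simp only [funext_iff (f := S.residual y), residual_apply, augOf, Pi.zero_apply, sub_eq_zero,
    Prod.ext_iff]
  constructor
  · intro h i j
    exact (congrFun (h i).2 j).trans (h j).1.symm
  · intro h i
    refine ⟨(S.average_eq_own h i).symm, funext fun j => ?_⟩
    exact (h i j).trans (S.average_eq_own h j).symm

/-! ### The total cost -/

/-- The own state at time `k`, as a linear function of the local variable. -/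
def ownAt (i : Fin S.M) (k : Fin (S.N + 1)) : S.LocalVar i →ₗ[ℝ] Fin (S.n i) → ℝ :=
  LinearMap.proj k ∘ₗ LinearMap.fst ℝ _ _ ∘ₗ LinearMap.fst ℝ _ _

/-- The copy of the state of the neighbor `j` at time `k`, as a linear function of the local
variable. -/
def copyAt (i : Fin S.M) (j : S.Nb i) (k : Fin (S.N + 1)) : S.LocalVar i →ₗ[ℝ] Fin (S.n j) → ℝ :=
  LinearMap.proj k ∘ₗ LinearMap.proj j ∘ₗ LinearMap.snd ℝ _ _ ∘ₗ LinearMap.fst ℝ _ _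

/-- The input at time `k`, as a linear function of the local variable. -/
def inpAt (i : Fin S.M) (k : Fin S.N) : S.LocalVar i →ₗ[ℝ] Fin (S.m i) → ℝ :=
  LinearMap.proj k ∘ₗ LinearMap.snd ℝ _ _

/-- The sum of the local costs, as a quadratic form; it plays the role of `F` in
`IsConsensusADMM`. -/
def totalCost : QuadraticForm ℝ S.Var :=
  ∑ i, ((∑ k : Fin S.N,
      ((S.Q i).toQuadraticForm'.comp (S.ownAt i k.castSucc)
        + (S.R i).toQuadraticForm'.comp (S.inpAt i k)
        + ∑ j : S.Nb i, (S.Qc i j).toQuadraticForm'.comp (S.copyAt i j k.castSucc)))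
    + (S.Phi i).toQuadraticForm'.comp (S.ownAt i (Fin.last S.N))).comp (LinearMap.proj i)

theorem totalCost_apply (y : S.Var) : S.totalCost y = ∑ i, S.cost i (y i) := by
  have hform : ∀ {d : ℕ} (M : Matrix (Fin d) (Fin d) ℝ) (v : Fin d → ℝ),
      M.toQuadraticForm' v = v ⬝ᵥ M *ᵥ v := fun M v => toLinearMap₂'_apply' M v v
  simp only [totalCost, _root_.sum_apply, _root_.add_apply, QuadraticMap.comp_apply,
    hform]
  rfl

/-! ### Closedness, convexity and definiteness -/

/-- The part of the assumptions that makes the local constraint sets closed and convex. -/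
structure ClosedConvexConstraints : Prop where
  X_closed : ∀ i, IsClosed (S.X i)
  X_convex : ∀ i, Convex ℝ (S.X i)
  U_closed : ∀ i, IsClosed (S.U i)
  U_convex : ∀ i, Convex ℝ (S.U i)
  P_closed : ∀ i l, IsClosed (S.P i l)
  P_convex : ∀ i l, Convex ℝ (S.P i l)
  XT_closed : ∀ i, IsClosed (S.XT i)
  XT_convex : ∀ i, Convex ℝ (S.XT i)

/-- The part of the assumptions that makes the costs convex. -/
structure PosDefCosts : Prop where
  Q_posDef : ∀ i, (S.Q i).PosDef
  R_posDef : ∀ i, (S.R i).PosDef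
  Phi_posDef : ∀ i, (S.Phi i).PosDef
  Qc_posSemidef : ∀ i, ∀ j ∈ S.nbr i, (S.Qc i j).PosSemidef

variable {S}

theorem Standing.closedConvexConstraints (hS : S.Standing) (h4 : S.TerminalAssumption) :
    S.ClosedConvexConstraints where
  X_closed i := by
    rw [← hS.P_cover i]
    exact isClosed_iUnion_of_finite fun l => (hS.P_polyhedron i l).isClosed
  X_convex := hS.X_convex
  U_closed := hS.U_closed
  U_convex := hS.U_convex
  P_closed i l := (hS.P_polyhedron i l).isClosed
  P_convex i l := (hS.P_polyhedron i l).convex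
  XT_closed := h4.closed
  XT_convex := h4.convex

theorem LyapunovAssumption.posDefCosts (h5 : S.LyapunovAssumption) : S.PosDefCosts :=
  ⟨h5.Q_posDef, h5.R_posDef, h5.Phi_posDef, h5.Qc_posSemidef⟩

/-! ### Coercivity of the total cost modulo consensus -/

namespace PosDefCosts

theorem stageCost_nonneg (hcost : S.PosDefCosts) (i : Fin S.M) (xi : Fin (S.n i) → ℝ)
    (ui : Fin (S.m i) → ℝ) (xj : ∀ j : S.Nb i, Fin (S.n j) → ℝ) :
    0 ≤ S.stageCost i xi ui xj :=
  add_nonneg (add_nonneg ((hcost.Q_posDef i).posSemidef.dotProduct_mulVec_nonneg xi)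
      ((hcost.R_posDef i).posSemidef.dotProduct_mulVec_nonneg ui))
    (Finset.sum_nonneg fun j _ => (hcost.Qc_posSemidef i j j.2).dotProduct_mulVec_nonneg (xj j))

theorem termCost_nonneg (hcost : S.PosDefCosts) (i : Fin S.M) (xi : Fin (S.n i) → ℝ) :
    0 ≤ S.termCost i xi :=
  (hcost.Phi_posDef i).posSemidef.dotProduct_mulVec_nonneg xi

theorem cost_nonneg (hcost : S.PosDefCosts) (i : Fin S.M) (y : S.LocalVar i) : 0 ≤ S.cost i y :=
  add_nonneg (Finset.sum_nonneg fun _ _ => hcost.stageCost_nonneg i _ _ _)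
    (hcost.termCost_nonneg i _)

theorem totalCost_nonneg (hcost : S.PosDefCosts) (y : S.Var) : 0 ≤ S.totalCost y := by
  rw [totalCost_apply]
  exact Finset.sum_nonneg fun i _ => hcost.cost_nonneg i (y i)

theorem eq_zero_of_stageCost_eq_zero (hcost : S.PosDefCosts) {i : Fin S.M}
    {xi : Fin (S.n i) → ℝ} {ui : Fin (S.m i) → ℝ} {xj : ∀ j : S.Nb i, Fin (S.n j) → ℝ}
    (h : S.stageCost i xi ui xj = 0) : xi = 0 ∧ ui = 0 := by
  have hQ := (hcost.Q_posDef i).posSemidef.dotProduct_mulVec_nonneg xi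
  have hR := (hcost.R_posDef i).posSemidef.dotProduct_mulVec_nonneg ui
  have hQc : 0 ≤ ∑ j : S.Nb i, xj j ⬝ᵥ (S.Qc i j *ᵥ xj j) := Finset.sum_nonneg fun j _ =>
    (hcost.Qc_posSemidef i j j.2).dotProduct_mulVec_nonneg (xj j)
  rw [star_trivial] at hQ hR
  rw [stageCost] at h
  refine ⟨of_not_not fun hxi => ?_, of_not_not fun hui => ?_⟩
  · have hpos := (hcost.Q_posDef i).dotProduct_mulVec_pos hxi
    rw [star_trivial] at hpos
    linarith
  · have hpos := (hcost.R_posDef i).dotProduct_mulVec_pos hui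
    rw [star_trivial] at hpos
    linarith

theorem eq_zero_of_termCost_eq_zero (hcost : S.PosDefCosts) {i : Fin S.M} {xi : Fin (S.n i) → ℝ}
    (h : S.termCost i xi = 0) : xi = 0 :=
  of_not_not fun hxi => ((hcost.Phi_posDef i).dotProduct_mulVec_pos hxi).ne' h

theorem eq_zero_of_cost_eq_zero (hcost : S.PosDefCosts) {i : Fin S.M} {y : S.LocalVar i}
    (h : S.cost i y = 0) : own y = 0 ∧ inp y = 0 := by
  rw [cost, add_eq_zero_iff_of_nonneg
    (Finset.sum_nonneg fun _ _ => hcost.stageCost_nonneg i _ _ _) (hcost.termCost_nonneg i _),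
    Finset.sum_eq_zero_iff_of_nonneg fun _ _ => hcost.stageCost_nonneg i _ _ _] at h
  have hstage := fun k => hcost.eq_zero_of_stageCost_eq_zero (h.1 k (Finset.mem_univ k))
  refine ⟨funext fun k => ?_, funext fun k => (hstage k).2⟩
  induction k using Fin.lastCases with
  | last => exact hcost.eq_zero_of_termCost_eq_zero h.2
  | cast k => exact (hstage k).1

theorem eq_zero_of_totalCost_eq_zero (hcost : S.PosDefCosts) {y : S.Var} (h : S.totalCost y = 0)
    (i : Fin S.M) : own (y i) = 0 ∧ inp (y i) = 0 := by
  rw [totalCost_apply, Finset.sum_eq_zero_iff_of_nonneg fun i _ => hcost.cost_nonneg i (y i)] at h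
  exact hcost.eq_zero_of_cost_eq_zero (h i (Finset.mem_univ i))

-- The cost controls the own trajectories and the inputs, the residual then controls the copies.
theorem posDef_totalCost_add_residual (hcost : S.PosDefCosts) :
    (S.totalCost + S.augForm.toQuadraticMap.comp S.residual).PosDef := by
  intro y hy
  have hF := hcost.totalCost_nonneg y
  have hr := S.isPosSemidef_augForm.nonneg (S.residual y)
  refine (add_nonneg hF hr).lt_of_ne' fun hzero => hy ?_
  obtain ⟨hcost_zero, hres⟩ := (add_eq_zero_iff_of_nonneg hF hr).1 hzero
  have hown := hcost.eq_zero_of_totalCost_eq_zero hcost_zero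
  have hcons := S.residual_eq_zero_iff.1 (S.augForm_self_eq_zero.1 hres)
  exact funext fun i => Prod.ext (Prod.ext (hown i).1 (funext fun j =>
    (hcons i j).trans (hown j).1)) (hown i).2

theorem exists_consensusPart_le (hcost : S.PosDefCosts) : ∃ c, 0 < c ∧ ∀ y : S.Var,
    S.augForm (S.consensusPart y) (S.consensusPart y) ≤
      c * (S.totalCost y + S.augForm (S.residual y) (S.residual y)) :=
  exists_quadraticForm_le_mul (S.augForm.toQuadraticMap.comp S.consensusPart)
    hcost.posDef_totalCost_add_residual

theorem exists_norm_sq_le (hcost : S.PosDefCosts) : ∃ c, 0 < c ∧ ∀ y : S.Var,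
    ‖y‖ ^ 2 ≤ c * (S.totalCost y + S.augForm (S.residual y) (S.residual y)) :=
  exists_norm_sq_le_mul hcost.posDef_totalCost_add_residual

end PosDefCosts

/-! ### The local constraint sets -/

namespace ClosedConvexConstraints

theorem isClosed_localSet (hcon : S.ClosedConvexConstraints) (i : Fin S.M)
    (xi : Fin (S.n i) → ℝ) : IsClosed (S.localSet i xi) := by
  simp only [localSet, Set.ofPred_and, Set.ofPred_forall]
  refine (isClosed_iInter fun k => ?coupled).inter ((isClosed_iInter fun k => ?state).inter
    ((isClosed_iInter fun k => ?input).inter (IsClosed.inter ?initial ?terminal)))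
  case coupled => exact isClosed_le (by unfold own copy; fun_prop) continuous_const
  case state => exact (hcon.X_closed i).preimage (by unfold own; fun_prop)
  case input => exact (hcon.U_closed i).preimage (by unfold inp; fun_prop)
  case initial => exact isClosed_eq (by unfold own; fun_prop) continuous_const
  case terminal => exact (hcon.XT_closed i).preimage (by unfold own; fun_prop)

theorem isClosed_switchSet (hcon : S.ClosedConvexConstraints) (i : Fin S.M)
    (s : S.Switching i) : IsClosed (S.switchSet i s) := by
  simp only [switchSet, Set.ofPred_and, Set.ofPred_forall]
  refine (isClosed_iInter fun k => ?dynamics).inter (isClosed_iInter fun k => ?region)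
  case dynamics =>
    exact isClosed_eq (by unfold own; fun_prop) (by unfold piece own inp copy; fun_prop)
  case region => exact (hcon.P_closed i _).preimage (by unfold own; fun_prop)

end ClosedConvexConstraints

theorem coupled_convexComb {i : Fin S.M} {x x' : Fin (S.n i) → ℝ}
    {xj xj' : ∀ j : S.Nb i, Fin (S.n j) → ℝ} (h : S.Coupled i x xj) (h' : S.Coupled i x' xj')
    {a b : ℝ} (ha : 0 ≤ a) (hb : 0 ≤ b) (hab : a + b = 1) :
    S.Coupled i (a • x + b • x') (a • xj + b • xj') :=
  calc S.H i *ᵥ (a • x + b • x') + ∑ j : S.Nb i, S.Hc i j *ᵥ (a • xj + b • xj') j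
      = a • (S.H i *ᵥ x + ∑ j : S.Nb i, S.Hc i j *ᵥ xj j)
        + b • (S.H i *ᵥ x' + ∑ j : S.Nb i, S.Hc i j *ᵥ xj' j) := by
        simp only [Pi.add_apply, Pi.smul_apply, mulVec_add, mulVec_smul, Finset.sum_add_distrib,
          ← Finset.smul_sum, smul_add]
        abel
    _ ≤ a • S.b i + b • S.b i :=
        add_le_add (smul_le_smul_of_nonneg_left h ha) (smul_le_smul_of_nonneg_left h' hb)
    _ = S.b i := Convex.combo_self hab _

theorem piece_convexComb (i : Fin S.M) (l : Fin (S.L i)) (x x' : Fin (S.n i) → ℝ)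
    (u u' : Fin (S.m i) → ℝ) (xj xj' : ∀ j : S.Nb i, Fin (S.n j) → ℝ) {a b : ℝ}
    (hab : a + b = 1) :
    S.piece i l (a • x + b • x') (a • u + b • u') (a • xj + b • xj') =
      a • S.piece i l x u xj + b • S.piece i l x' u' xj' := by
  have hc : a • S.c i l + b • S.c i l = S.c i l := Convex.combo_self hab _
  simp only [piece, Pi.add_apply, Pi.smul_apply, mulVec_add, mulVec_smul, Finset.sum_add_distrib,
    ← Finset.smul_sum, smul_add]
  nth_rewrite 1 [← hc]
  abel

namespace ClosedConvexConstraints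

theorem convex_localSet (hcon : S.ClosedConvexConstraints) (i : Fin S.M)
    (xi : Fin (S.n i) → ℝ) : Convex ℝ (S.localSet i xi) := by
  rintro y ⟨hy_coupled, hy_state, hy_input, hy_initial, hy_terminal⟩
    w ⟨hw_coupled, hw_state, hw_input, hw_initial, hw_terminal⟩ a b ha hb hab
  refine ⟨fun k => coupled_convexComb (hy_coupled k) (hw_coupled k) ha hb hab,
    fun k => hcon.X_convex i (hy_state k) (hw_state k) ha hb hab,
    fun k => hcon.U_convex i (hy_input k) (hw_input k) ha hb hab, ?_,
    hcon.XT_convex i hy_terminal hw_terminal ha hb hab⟩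
  change a • own y 0 + b • own w 0 = xi
  rw [hy_initial, hw_initial, Convex.combo_self hab]

theorem convex_switchSet (hcon : S.ClosedConvexConstraints) (i : Fin S.M)
    (s : S.Switching i) : Convex ℝ (S.switchSet i s) := by
  rintro y ⟨hy_dyn, hy_region⟩ w ⟨hw_dyn, hw_region⟩ a b ha hb hab
  refine ⟨fun k => ?_, fun k => hcon.P_convex i _ (hy_region k) (hw_region k) ha hb hab⟩
  change a • own y k.succ + b • own w k.succ = _
  rw [hy_dyn k, hw_dyn k, ← piece_convexComb i _ _ _ _ _ _ _ hab]
  rfl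

end ClosedConvexConstraints

variable (S) in
/-- The feasible set of `P_s(x)` without the consistency requirement: the set over which the local
minimizations of the switching ADMM procedure jointly range. -/
def uncoupledSet (s : ∀ i, S.Switching i) (x : S.State) : Set S.Var :=
  Set.univ.pi fun i => S.localSet i (x i) ∩ S.switchSet i (s i)

theorem mem_feasibleSetOf {s : ∀ i, S.Switching i} {x : S.State} {y : S.Var} :
    y ∈ S.feasibleSetOf s x ↔ y ∈ S.uncoupledSet s x ∧ S.residual y = 0 := by
  rw [residual_eq_zero_iff]
  exact and_congr_left' Set.mem_univ_pi.symm

theorem ClosedConvexConstraints.isClosed_uncoupledSet (hcon : S.ClosedConvexConstraints)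
    (s : ∀ i, S.Switching i) (x : S.State) : IsClosed (S.uncoupledSet s x) :=
  isClosed_set_pi fun i _ => (hcon.isClosed_localSet i _).inter (hcon.isClosed_switchSet i _)

theorem ClosedConvexConstraints.convex_uncoupledSet (hcon : S.ClosedConvexConstraints)
    (s : ∀ i, S.Switching i) (x : S.State) : Convex ℝ (S.uncoupledSet s x) :=
  convex_pi fun i _ => (hcon.convex_localSet i _).inter (hcon.convex_switchSet i _)

/-! ### Boundedness of the switching ADMM iterates -/

theorem augmentedLagrangian_eq_sum (lam ζ : ∀ i, S.AugTraj i) (y : S.Var) :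
    augmentedLagrangian S.augForm (S.consensusPart + S.residual) S.totalCost S.rho lam ζ y =
      ∑ i, S.augLagrangian i (lam i) (ζ i) (y i) := by
  simp only [augmentedLagrangian, augLagrangian, totalCost_apply, augForm_apply, Pi.sub_apply,
    consensusPart_add_residual_apply, Finset.sum_add_distrib, Finset.mul_sum]

namespace IsSwADMM

variable {x : S.State} {v : ∀ i, S.InputSeq i} {ydr : S.Var} {s : ℕ → ∀ i, S.Switching i}
  {y : ℕ → S.Var} {z : ℕ → ∀ i, S.Traj i} {lam : ℕ → ∀ i, S.AugTraj i}

theorem switching_eq (h : S.IsSwADMM x v ydr s y z lam) {τ : ℕ} (hτ : S.Tcut ≤ τ) :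
    s τ = s S.Tcut := by
  induction τ, hτ using Nat.le_induction with
  | base => rfl
  | succ τ hτ ih => rw [h.s_frozen τ hτ, ih]

theorem augOf_z_succ (h : S.IsSwADMM x v ydr s y z lam) (τ : ℕ) :
    S.augOf (z (τ + 1)) = S.consensusPart (y (τ + 1)) := by
  rw [consensusPart_apply, ← funext (h.z_succ τ)]

theorem multiplier_succ (h : S.IsSwADMM x v ydr s y z lam) (τ : ℕ) :
    lam (τ + 1) = lam τ + S.rho • S.residual (y (τ + 1)) := by
  funext i
  rw [h.lam_succ τ i, funext (h.z_succ τ)]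
  rfl

theorem mem_uncoupledSet (h : S.IsSwADMM x v ydr s y z lam) {τ : ℕ} (hτ : S.Tcut ≤ τ) :
    y (τ + 1) ∈ S.uncoupledSet (s S.Tcut) x := by
  rw [← h.switching_eq hτ]
  exact fun i _ => h.y_mem τ i

theorem isMinOn_augmentedLagrangian (h : S.IsSwADMM x v ydr s y z lam) (τ : ℕ) :
    IsMinOn (augmentedLagrangian S.augForm (S.consensusPart + S.residual) S.totalCost S.rho
      (lam τ) (S.augOf (z τ))) (S.uncoupledSet (s τ) x) (y (τ + 1)) := by
  refine isMinOn_iff.2 fun w hw => ?_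
  rw [augmentedLagrangian_eq_sum, augmentedLagrangian_eq_sum]
  exact Finset.sum_le_sum fun i _ => h.y_min τ i (w i) (hw i (Set.mem_univ i))

theorem isConsensusADMM (h : S.IsSwADMM x v ydr s y z lam) :
    IsConsensusADMM S.augForm S.consensusPart S.residual S.totalCost
      (S.uncoupledSet (s S.Tcut) x) S.rho (fun n => y (n + (S.Tcut + 1)))
      (fun n => lam (n + (S.Tcut + 1))) where
  mem n := h.mem_uncoupledSet (Nat.le_add_left S.Tcut n)
  isMinOn n := by
    have hmin := h.isMinOn_augmentedLagrangian (n + S.Tcut + 1)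
    rw [h.augOf_z_succ, h.switching_eq (by omega)] at hmin
    rw [add_right_comm n 1]
    exact hmin
  lam_zero := bilin_multiplier_consensus_eq_zero S.augForm_residual_consensusPart
    (fun w => by rw [h.lam_zero, map_zero, LinearMap.zero_apply]) h.multiplier_succ _
  lam_succ n := by
    rw [add_right_comm n 1]
    exact h.multiplier_succ _

theorem feasibleSetOf_nonempty (h : S.IsSwADMM x v ydr s y z lam) (h1 : S.SwitchingAssumption)
    (hx : x ∈ S.feasibleStates) : (S.feasibleSetOf (s S.Tcut) x).Nonempty :=
  Set.nonempty_iff_ne_empty.2 fun hempty =>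
    h1 x hx ⟨s S.Tcut, hempty, fun i => ⟨_, h.y_mem S.Tcut i⟩⟩

variable (hcon : S.ClosedConvexConstraints) (hcost : S.PosDefCosts) (hρ : 0 < S.rho)
include hcon hcost hρ

theorem bddAbove_totalCost_and_residual_tendsto (h : S.IsSwADMM x v ydr s y z lam) {w : S.Var}
    (hw : w ∈ S.feasibleSetOf (s S.Tcut) x) :
    BddAbove (Set.range fun n => S.totalCost (w - y (n + (S.Tcut + 2)))) ∧
      Tendsto (fun n => S.augForm (S.residual (y n)) (S.residual (y n))) atTop (𝓝 0) := by
  obtain ⟨hwC, hrw⟩ := mem_feasibleSetOf.1 hw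
  obtain ⟨c, hc, hcoercive⟩ := hcost.exists_consensusPart_le
  obtain ⟨hbdd, hlim⟩ := h.isConsensusADMM.bddAbove_cost_and_residual_tendsto
    S.isPosSemidef_augForm S.augForm_residual_consensusPart hcost.totalCost_nonneg hc hcoercive
    (hcon.convex_uncoupledSet _ _) hρ hwC hrw
  refine ⟨?_, (tendsto_add_atTop_iff_nat (S.Tcut + 1)).1 hlim⟩
  simpa only [add_assoc, add_left_comm 1] using hbdd

theorem exists_eventually_mem_closedBall (h : S.IsSwADMM x v ydr s y z lam) {w : S.Var}
    (hw : w ∈ S.feasibleSetOf (s S.Tcut) x) :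
    ∃ K, ∀ᶠ n in atTop, y n ∈ Metric.closedBall w K := by
  obtain ⟨⟨K, hK⟩, hlim⟩ := h.bddAbove_totalCost_and_residual_tendsto hcon hcost hρ hw
  obtain ⟨c, hc, hnorm⟩ := hcost.exists_norm_sq_le
  refine ⟨√(c * (K + 1)), ?_⟩
  filter_upwards [hlim.eventually_le_const one_pos, eventually_ge_atTop (S.Tcut + 2)]
    with n hres hn
  obtain ⟨m, rfl⟩ := Nat.exists_eq_add_of_le' hn
  have hle := hnorm (w - y (m + (S.Tcut + 2)))
  rw [map_sub S.residual, (mem_feasibleSetOf.1 hw).2, zero_sub, map_neg, map_neg,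
    LinearMap.neg_apply, neg_neg] at hle
  rw [Metric.mem_closedBall', dist_eq_norm]
  exact Real.le_sqrt_of_sq_le (hle.trans
    (mul_le_mul_of_nonneg_left (add_le_add (hK (Set.mem_range_self m)) hres) hc.le))

theorem exists_mapClusterPt (h : S.IsSwADMM x v ydr s y z lam)
    (hne : (S.feasibleSetOf (s S.Tcut) x).Nonempty) : ∃ yout, MapClusterPt yout atTop y := by
  obtain ⟨w, hw⟩ := hne
  obtain ⟨K, hK⟩ := h.exists_eventually_mem_closedBall hcon hcost hρ hw
  obtain ⟨yout, -, hyout⟩ :=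
    (isCompact_closedBall w K).exists_mapClusterPt_of_frequently hK.frequently
  exact ⟨yout, hyout⟩

theorem mem_feasibleSetOf_of_mapClusterPt (h : S.IsSwADMM x v ydr s y z lam)
    (hne : (S.feasibleSetOf (s S.Tcut) x).Nonempty) {yout : S.Var}
    (hyout : MapClusterPt yout atTop y) : yout ∈ S.feasibleSetOf (s S.Tcut) x := by
  obtain ⟨w, hw⟩ := hne
  refine mem_feasibleSetOf.2 ⟨?_, S.augForm_self_eq_zero.1 ?_⟩
  · refine (hcon.isClosed_uncoupledSet _ x).mem_of_mapClusterPt hyout ?_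
    filter_upwards [eventually_ge_atTop (S.Tcut + 1)] with n hn
    obtain ⟨m, rfl⟩ := Nat.exists_eq_add_of_le' hn
    exact h.mem_uncoupledSet (Nat.le_add_left S.Tcut m)
  · have hlim := (h.bddAbove_totalCost_and_residual_tendsto hcon hcost hρ hw).2
    have hcont := continuous_quadraticForm (S.augForm.toQuadraticMap.comp S.residual)
    obtain ⟨φ, hφ, hsub⟩ := hyout.tendsto_subseq
    exact tendsto_nhds_unique ((hcont.tendsto yout).comp hsub) (hlim.comp hφ.tendsto_atTop)

end IsSwADMM

/-! ### Recursive feasibility -/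

variable (S)

/-- The part of the terminal assumptions that makes the terminal set a positively invariant set of
feasible states. -/
structure TerminalInvariance : Prop where
  subset : ∀ i, S.XT i ⊆ S.X i
  covered : ∀ i, S.XT i ⊆ ⋃ l, S.P i l
  input_mem : ∀ i, ∀ xi ∈ S.XT i, ∀ l, xi ∈ S.P i l → S.K i l *ᵥ xi ∈ S.U i
  invariant : ∀ i, ∀ xi ∈ S.XT i, ∀ xj : ∀ j : S.Nb i, Fin (S.n j) → ℝ,
    (∀ j : S.Nb i, xj j ∈ S.XT j) → ∀ l, xi ∈ S.P i l →
      S.piece i l xi (S.K i l *ᵥ xi) xj ∈ S.XT i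
  coupled : ∀ x ∈ S.terminalSet, ∀ i, S.Coupled i (x i) (fun j => x j)

/-- The successor of the state `x` under the terminal controllers of the regions `l`. -/
def terminalSucc (l : ∀ i, Fin (S.L i)) (x : S.State) : S.State := fun i =>
  S.piece i (l i) (x i) (S.K i (l i) *ᵥ x i) (fun j => x j)

/-- The candidate solution for the next time step: drop the first state and the first input of `y`,
and append one step of the terminal controllers of the regions `l`. -/
def shift (l : ∀ i, Fin (S.L i)) (y : S.Var) : S.Var :=
  let xN : S.State := fun i => own (y i) (Fin.last S.N)
  let X : ∀ i, S.Traj i := fun i =>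
    Fin.snoc (α := fun _ => Fin (S.n i) → ℝ) (fun k => own (y i) k.succ) (S.terminalSucc l xN i)
  fun i => ((X i, fun j => X j), fun k =>
    if h : (k : ℕ) + 1 < S.N then inp (y i) ⟨k + 1, h⟩ else S.K i (l i) *ᵥ xN i)

variable {S}

theorem Standing.terminalInvariance (hS : S.Standing) (h4 : S.TerminalAssumption) :
    S.TerminalInvariance := by
  have hcovered : ∀ i, S.XT i ⊆ ⋃ l, S.P i l := fun i =>
    (h4.subset i).trans (Set.iUnion₂_subset_iUnion _ _)
  exact
    { subset := fun i => (hcovered i).trans (hS.P_cover i).subset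
      covered := hcovered
      input_mem := h4.input_mem
      invariant := h4.invariant
      coupled := h4.coupled }

section Shift

variable (l : ∀ i, Fin (S.L i)) (y : S.Var) (i : Fin S.M)

theorem consistent_shift : S.Consistent (S.shift l y) := fun _ _ => rfl

theorem own_shift_castSucc (k : Fin S.N) :
    own (S.shift l y i) k.castSucc = own (y i) k.succ := by
  simp only [shift, own, Fin.snoc_castSucc]

theorem own_shift_last : own (S.shift l y i) (Fin.last S.N) =
    S.terminalSucc l (fun j => own (y j) (Fin.last S.N)) i := by
  simp only [shift, own, Fin.snoc_last]

theorem inp_shift_of_lt {k : Fin S.N} (h : (k : ℕ) + 1 < S.N) :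
    inp (S.shift l y i) k = inp (y i) ⟨k + 1, h⟩ :=
  dif_pos h

theorem inp_shift_of_not_lt {k : Fin S.N} (h : ¬ (k : ℕ) + 1 < S.N) :
    inp (S.shift l y i) k = S.K i (l i) *ᵥ own (y i) (Fin.last S.N) :=
  dif_neg h

end Shift

theorem TerminalInvariance.terminalSucc_mem (hterm : S.TerminalInvariance) {x : S.State}
    (hx : x ∈ S.terminalSet) {l : ∀ i, Fin (S.L i)} (hl : ∀ i, x i ∈ S.P i (l i)) :
    S.terminalSucc l x ∈ S.terminalSet := fun i =>
  hterm.invariant i _ (hx i) _ (fun j => hx j) (l i) (hl i)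

section ShiftFeasible

variable {x : S.State} {y : S.Var} {l : ∀ i, Fin (S.L i)}

theorem shift_mem_localSet (hterm : S.TerminalInvariance) (hy : y ∈ S.feasibleSet x)
    (hl : ∀ i, own (y i) (Fin.last S.N) ∈ S.P i (l i)) (i : Fin S.M) :
    S.shift l y i ∈ S.localSet i (own (S.shift l y i) 0) := by
  obtain ⟨hloc, -, hcons⟩ := hy
  have hxN : (fun j => own (y j) (Fin.last S.N)) ∈ S.terminalSet := fun j => (hloc j).2.2.2.2
  have hsucc := hterm.terminalSucc_mem hxN hl
  refine ⟨fun k => ?coupled, fun k => ?state, fun k => ?input, rfl, ?terminal⟩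
  case coupled =>
    simp only [S.consistent_shift l y i]
    induction k using Fin.lastCases with
    | last =>
      simp only [own_shift_last]
      exact hterm.coupled _ hsucc i
    | cast k =>
      have hcoupled := (hloc i).1 k.succ
      simp only [hcons i] at hcoupled
      simpa only [own_shift_castSucc] using hcoupled
  case state =>
    induction k using Fin.lastCases with
    | last =>
      rw [own_shift_last]
      exact hterm.subset i (hsucc i)
    | cast k =>
      rw [own_shift_castSucc]
      exact (hloc i).2.1 k.succ
  case input =>
    by_cases hk : (k : ℕ) + 1 < S.N
    · rw [inp_shift_of_lt l y i hk]
      exact (hloc i).2.2.1 _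
    · rw [inp_shift_of_not_lt l y i hk]
      exact hterm.input_mem i _ (hxN i) _ (hl i)
  case terminal =>
    rw [own_shift_last]
    exact hsucc i

theorem next_shift (hy : y ∈ S.feasibleSet x)
    (hl : ∀ i, own (y i) (Fin.last S.N) ∈ S.P i (l i)) (i : Fin S.M) (k : Fin S.N) :
    S.Next i (own (S.shift l y i) k.castSucc) (inp (S.shift l y i) k)
      (fun j => copy (S.shift l y i) j k.castSucc) (own (S.shift l y i) k.succ) := by
  obtain ⟨-, hdyn, hcons⟩ := hy
  simp only [consistent_shift l y i, own_shift_castSucc]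
  by_cases hk : (k : ℕ) + 1 < S.N
  · have hnext := hdyn i ⟨k + 1, hk⟩
    simp only [hcons i] at hnext
    rw [inp_shift_of_lt l y i hk,
      show k.succ = (⟨k + 1, hk⟩ : Fin S.N).castSucc from rfl, own_shift_castSucc]
    exact hnext
  · have hlast : k.succ = Fin.last S.N := by
      rw [Fin.ext_iff, Fin.val_succ, Fin.val_last]
      omega
    simp only [inp_shift_of_not_lt l y i hk, hlast, own_shift_last]
    exact ⟨l i, hl i, rfl⟩

theorem shift_mem_feasibleSet (hterm : S.TerminalInvariance) (hy : y ∈ S.feasibleSet x)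
    (hl : ∀ i, own (y i) (Fin.last S.N) ∈ S.P i (l i)) :
    S.shift l y ∈ S.feasibleSet fun i => own (S.shift l y i) 0 :=
  ⟨shift_mem_localSet hterm hy hl, next_shift hy hl, consistent_shift l y⟩

end ShiftFeasible

theorem mem_feasibleStates_of_eq_second_state (hterm : S.TerminalInvariance) (hN : 0 < S.N)
    {x x' : S.State} {y : S.Var} (hy : y ∈ S.feasibleSet x)
    (hx' : ∀ i, x' i = own (y i) (Fin.succ ⟨0, hN⟩)) : x' ∈ S.feasibleStates := by
  choose l hl using fun i => Set.mem_iUnion.1 (hterm.covered i (hy.1 i).2.2.2.2)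
  have hinit : x' = fun i => own (S.shift l y i) 0 := funext fun i =>
    (hx' i).trans (own_shift_castSucc l y i ⟨0, hN⟩).symm
  exact ⟨S.shift l y, hinit ▸ shift_mem_feasibleSet hterm hy hl⟩

theorem feasibleSetOf_subset_feasibleSet (s : ∀ i, S.Switching i) (x : S.State) :
    S.feasibleSetOf s x ⊆ S.feasibleSet x := fun _ hy =>
  ⟨fun i => (hy.1 i).1, fun i k => ⟨s i k.castSucc, (hy.1 i).2.2 _, (hy.1 i).2.1 k⟩, hy.2⟩

-- An infeasible rollout has infinite cost, so it never replaces the output of the procedure.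
theorem OptStep.mem_feasibleSet (hcon : S.ClosedConvexConstraints) (hcost : S.PosDefCosts)
    (hρ : 0 < S.rho) (h1 : S.SwitchingAssumption) {x : S.State} (hx : x ∈ S.feasibleStates)
    {v : ∀ i, S.InputSeq i} {y : S.Var} (h : S.OptStep x v y) : y ∈ S.feasibleSet x := by
  obtain ⟨ydr, yout, -, ⟨s, yit, z, lam, hadmm, hcluster⟩, haccept, hreject⟩ := h
  by_cases hle : ∀ i, ((S.cost i (yout i) : ℝ) : EReal) ≤ S.rolloutCost x ydr i
  · rw [haccept hle]
    exact feasibleSetOf_subset_feasibleSet _ _ (hadmm.mem_feasibleSetOf_of_mapClusterPt hcon hcost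
      hρ (hadmm.feasibleSetOf_nonempty h1 hx) hcluster)
  · rw [hreject hle]
    by_contra hydr
    exact hle fun i => by simp only [rolloutCost, hydr, if_false, le_top]

theorem UnambiguousAt.eq_piece {x : S.State} {u : S.Input} (h : S.UnambiguousAt x u) {i : Fin S.M}
    {xi : Fin (S.n i) → ℝ} (hnext : S.Next i (x i) (u i) (fun j => x j) xi) {l : Fin (S.L i)}
    (hl : x i ∈ S.P i l) : xi = S.piece i l (x i) (u i) (fun j => x j) := by
  obtain ⟨l', hl', rfl⟩ := hnext
  exact h i l' l hl' hl

namespace IsClosedLoop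

variable {T : ℕ} {x : ℕ → S.State} {v : ℕ → ∀ i, S.InputSeq i} {y : ℕ → S.Var} {u : ℕ → S.Input}

theorem mem_terminalSet_succ (hterm : S.TerminalInvariance) (hloop : S.IsClosedLoop T x v y u)
    {t : ℕ} (ht : t < T) (hwell : S.UnambiguousAt (x t) (u t)) (hx : x t ∈ S.terminalSet) :
    x (t + 1) ∈ S.terminalSet := by
  intro i
  obtain ⟨l, hl, hu⟩ := hloop.terminal t ht hx i
  rw [hwell.eq_piece (hloop.plant t ht i) hl, hu]
  exact hterm.invariant i _ (hx i) _ (fun j => hx j) l hl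

theorem state_succ_eq (hN : 0 < S.N) (hloop : S.IsClosedLoop T x v y u) {t : ℕ} (ht : t < T)
    (hwell : S.UnambiguousAt (x t) (u t)) (hxT : x t ∉ S.terminalSet)
    (hy : y t ∈ S.feasibleSet (x t)) (i : Fin S.M) :
    x (t + 1) i = own (y t i) (Fin.succ ⟨0, hN⟩) := by
  obtain ⟨hloc, hdyn, hcons⟩ := hy
  have hinit : ∀ i, own (y t i) (Fin.castSucc ⟨0, hN⟩) = x t i := fun i => (hloc i).2.2.2.1
  obtain ⟨l, hl, hstep⟩ := hdyn i ⟨0, hN⟩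
  simp only [hcons i, hinit] at hstep
  rw [hinit] at hl
  rw [hstep, hwell.eq_piece (hloop.plant t ht i) hl, hloop.apply_first t ht hxT i hN]

variable (hcon : S.ClosedConvexConstraints) (hcost : S.PosDefCosts)
  (hterm : S.TerminalInvariance) (hN : 0 < S.N) (hρ : 0 < S.rho) (h1 : S.SwitchingAssumption)
include hcon hcost hterm hN hρ h1

theorem mem_feasibleStates_succ (hloop : S.IsClosedLoop T x v y u) {t : ℕ} (ht : t < T)
    (hwell : S.UnambiguousAt (x t) (u t)) (hxT : x t ∉ S.terminalSet)
    (hx : x t ∈ S.feasibleStates) : x (t + 1) ∈ S.feasibleStates := by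
  have hy := (hloop.optimize t ht hxT).mem_feasibleSet hcon hcost hρ h1 hx
  exact mem_feasibleStates_of_eq_second_state hterm hN hy
    (hloop.state_succ_eq hN ht hwell hxT hy)

theorem mem_terminalSet_or_mem_feasibleStates (hloop : S.IsClosedLoop T x v y u)
    (hwell : ∀ t < T, S.UnambiguousAt (x t) (u t)) (hx0 : x 0 ∈ S.feasibleStates) {t : ℕ}
    (ht : t ≤ T) : x t ∈ S.terminalSet ∨ x t ∈ S.feasibleStates := by
  induction t with
  | zero => exact Or.inr hx0
  | succ t ih =>
    rcases em (x t ∈ S.terminalSet) with hxT | hxT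
    · exact Or.inl (hloop.mem_terminalSet_succ hterm ht (hwell t ht) hxT)
    · have hx := (ih (Nat.le_of_succ_le ht)).resolve_left hxT
      exact Or.inr
        (hloop.mem_feasibleStates_succ hcon hcost hterm hN hρ h1 ht (hwell t ht) hxT hx)

end IsClosedLoop

end PWANetwork

theorem theorem1_general (S : PWANetwork) (hcon : S.ClosedConvexConstraints)
    (hcost : S.PosDefCosts) (hterm : S.TerminalInvariance) (hN : 0 < S.N) (hρ : 0 < S.rho)
    (h1 : S.SwitchingAssumption)
    (T : ℕ) (x : ℕ → S.State) (v : ℕ → ∀ i, S.InputSeq i) (y : ℕ → S.Var) (u : ℕ → S.Input)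
    (hx0 : x 0 ∈ S.feasibleStates) (hloop : S.IsClosedLoop T x v y u)
    (hwell : ∀ t < T, S.UnambiguousAt (x t) (u t)) :
    ∀ t ≤ T, x t ∉ S.terminalSet →
      (S.feasibleSet (x t)).Nonempty ∧
      ∀ w ydr s yit z lam, S.IsSwADMM (x t) w ydr s yit z lam →
        ∃ yout, MapClusterPt yout atTop yit := by
  intro t ht hxT
  have hx : x t ∈ S.feasibleStates := (hloop.mem_terminalSet_or_mem_feasibleStates hcon hcost
    hterm hN hρ h1 hwell hx0 ht).resolve_left hxT
  refine ⟨hx, fun w ydr s yit z lam hadmm => ?_⟩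
  exact hadmm.exists_mapClusterPt hcon hcost hρ (hadmm.feasibleSetOf_nonempty h1 hx)

theorem theorem1 (S : PWANetwork) (hS : S.Standing) (h1 : S.SwitchingAssumption)
    (h3 : S.SystemAssumption) (h4 : S.TerminalAssumption) (h5 : S.LyapunovAssumption)
    (T : ℕ) (x : ℕ → S.State) (v : ℕ → ∀ i, S.InputSeq i) (y : ℕ → S.Var) (u : ℕ → S.Input)
    (hx0 : x 0 ∈ S.feasibleStates \ S.terminalSet) (h6 : S.WeaklyFeasible (x 0) (v 0))
    (hloop : S.IsClosedLoop T x v y u) (hwell : ∀ t < T, S.UnambiguousAt (x t) (u t)) :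
    ∀ t ≤ T, x t ∉ S.terminalSet →
      (S.feasibleSet (x t)).Nonempty ∧
      ∀ w ydr s yit z lam, S.IsSwADMM (x t) w ydr s yit z lam →
        ∃ yout, MapClusterPt yout atTop yit :=
  theorem1_general S (hS.closedConvexConstraints h4) h5.posDefCosts (hS.terminalInvariance h4)
    hS.N_pos hS.rho_pos h1 T x v y u hx0.1 hloop hwell
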